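/- **Theorem 4.1.** In the channel $0<y<1$ (coordinates $(x,y,z)$) consider, for $A>0$ and an integer $n\ge 1$, the steady shears $(U(y),0,W_n(y))$ with $U(y)=y$ and $W_n(y)=\frac{A}{n}\sin(4n\pi y)$. For every $A>0$ there is a constant $C>0$, independent of $n$, such that the following holds for every integer $n\ge 1$. (1) The shear is linearly unstable under 3D Euler: the 3D Euler equations linearized at $(U,0,W_n)$, $\partial_t u+(B\cdot\nabla)u+(u\cdot\nabla)B=-\nabla p$, $\nabla\cdot u=0$ with $B=(U,0,W_n)$ and $u_2=0$ at $y=0,1$, have a smooth normal mode solution $(u,p)=e^{ik_1x+ik_3z-i\sigma t}(\hat u(y),\hat p(y))$, $k_1,k_3\in\mathbb R$, with $\hat u\not\equiv 0$ and $\operatorname{Im}\sigma>0$. (2) Consider the Rayleigh equation $$v''-\frac{k_1U''+k_3W_n''}{k_1U+k_3W_n-\sigma}\,v=(k_1^2+k_3^2)\,v\quad\text{on }(0,1),\qquad v(0)=v(1)=0. \tag{R}$$ An eigenfunction of (R) is a not identically zero $v\in C([0,1])\cap C^2((0,1))$ that satisfies the boundary conditions and satisfies the equation wherever $k_1U+k_3W_n\ne\sigma$.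 There is a two-dimensional surface of unstable eigenmodes: there are a nonempty connected open set $\Omega\subset\mathbb R^2$ and a continuous function $\sigma:\Omega\to\mathbb C$ such that for all $(k_1,k_3)\in\Omega$, $\operatorname{Im}\sigma(k_1,k_3)>0$ and (R) with $\sigma=\sigma(k_1,k_3)$ has an eigenfunction. This surface stems from a curve of neutral modes $(k_1,k_3;\tfrac12k_1)$: there are a nonempty open interval $J\subset\mathbb{R}$ and a continuous function $K:J\to\mathbb R$ such that for every $\kappa\in J$ the point $(k_1,k_3)=(K(\kappa),\kappa K(\kappa))$ satisfies $k_1^2+k_3^2\ge Cn^2$, equation (R) with this $(k_1,k_3)$ and $\sigma=\tfrac12k_1$ has an eigenfunction, $(k_1,k_3)$ lies on the boundary of $\Omega$, and $\sigma(k_1',k_3')\to\tfrac12k_1$ as $(k_1',k_3')\to(k_1,k_3)$ in $\Omega$. All eigenfunctions of (R) for these unstable and neutral modes are in $C^\infty(0,1)$. -/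

import Mathlib

open Set Filter Topology
open scoped ContDiff

noncomputable section

/-- The closed channel `a ≤ y ≤ b` in `ℝ³`, with coordinates `(x, y, z) = (X 0, X 1, X 2)`. -/
def closedChannel (a b : ℝ) : Set (Fin 3 → ℝ) := {X | X 1 ∈ Icc a b}

/-- The open channel `a < y < b` in `ℝ³`. -/
def openChannel (a b : ℝ) : Set (Fin 3 → ℝ) := {X | X 1 ∈ Ioo a b}

/-- The type II shear `(U(y), 0, W(y))`. -/
def typeIIShear (U W : ℝ → ℝ) (X : Fin 3 → ℝ) : Fin 3 → ℝ := ![U (X 1), 0, W (X 1)]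

/-- The partial derivative `∂f/∂X_j` at the point `X`. -/
def partialD {F : Type*} [NormedAddCommGroup F] [NormedSpace ℝ F] (j : Fin 3)
    (f : (Fin 3 → ℝ) → F) (X : Fin 3 → ℝ) : F :=
  lineDeriv ℝ f X (Pi.single j 1)

/-- `(u, p)` is a classical (smooth) solution, for all times, of the 3D Euler equations linearized
at the steady flow `B` in the channel `a < y < b`,
`∂ₜ u + (B · ∇) u + (u · ∇) B = - ∇p`, `∇ · u = 0`,
with the non-penetrating condition `u₂ = 0` at the walls. The fields are complex valued: the system
is linear with real coefficients, so real and imaginary parts are real solutions. -/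
structure IsLinearizedEulerSolution (a b : ℝ) (B : (Fin 3 → ℝ) → Fin 3 → ℝ)
    (u : ℝ → (Fin 3 → ℝ) → Fin 3 → ℂ) (p : ℝ → (Fin 3 → ℝ) → ℂ) : Prop where
  smooth_velocity : ContDiffOn ℝ ∞ (fun q : ℝ × (Fin 3 → ℝ) => u q.1 q.2) (univ ×ˢ openChannel a b)
  smooth_pressure : ContDiffOn ℝ ∞ (fun q : ℝ × (Fin 3 → ℝ) => p q.1 q.2) (univ ×ˢ openChannel a b)
  continuous_velocity :
    ContinuousOn (fun q : ℝ × (Fin 3 → ℝ) => u q.1 q.2) (univ ×ˢ closedChannel a b)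
  continuous_pressure :
    ContinuousOn (fun q : ℝ × (Fin 3 → ℝ) => p q.1 q.2) (univ ×ˢ closedChannel a b)
  momentum : ∀ t : ℝ, ∀ X ∈ openChannel a b, ∀ i : Fin 3,
    deriv (fun s => u s X i) t
        + ∑ j, (B X j : ℂ) * partialD j (fun Y => u t Y i) X
        + ∑ j, u t X j * ((partialD j (fun Y => B Y i) X : ℝ) : ℂ)
      = - partialD i (p t) X
  divergence_free : ∀ t : ℝ, ∀ X ∈ openChannel a b, ∑ j, partialD j (fun Y => u t Y j) X = 0
  non_penetrating : ∀ t : ℝ, ∀ X : Fin 3 → ℝ, X 1 = a ∨ X 1 = b → u t X 1 = 0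

/-- The normal mode `exp(i k₁ x + i k₃ z - i σ t) φ(y)`. -/
def normalMode {F : Type*} [SMul ℂ F] (k₁ k₃ : ℝ) (σ : ℂ) (φ : ℝ → F) (t : ℝ) (X : Fin 3 → ℝ) : F :=
  Complex.exp (Complex.I * (k₁ * X 0 + k₃ * X 2 - σ * t)) • φ (X 1)

/-- The shear `(U(y), 0, W(y))` in the channel `a < y < b` is linearly unstable under 3D Euler: the
linearized 3D Euler equations have a normal mode with nonzero velocity and with `Im σ > 0`, that is,
with exponential growth in time. -/
def LinearlyUnstable (a b : ℝ) (U W : ℝ → ℝ) : Prop :=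
  ∃ (k₁ k₃ : ℝ) (σ : ℂ) (φ : ℝ → Fin 3 → ℂ) (q : ℝ → ℂ),
    0 < σ.im ∧ (∃ y ∈ Ioo a b, φ y ≠ 0) ∧
    IsLinearizedEulerSolution a b (typeIIShear U W) (normalMode k₁ k₃ σ φ) (normalMode k₁ k₃ σ q)

/-- `v` is an eigenfunction, with wave numbers `(k₁, k₃)` and eigenvalue `σ`, of the Rayleigh
equation of the shear `(U(y), 0, W(y))`,
`v'' - (k₁ U'' + k₃ W'') / (k₁ U + k₃ W - σ) v = (k₁² + k₃²) v`, `v(a) = v(b) = 0`.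
If `σ` is not real, the condition in `rayleigh` holds at every `y`. If `σ` is real (a neutral
mode), the equation is imposed wherever its denominator is nonzero; since `v''` is
continuous on all of `(a, b)`, it then holds with the continuous extension of the quotient at
removable singularities. -/
structure IsRayleighMode (a b : ℝ) (U W : ℝ → ℝ) (k₁ k₃ : ℝ) (σ : ℂ) (v : ℝ → ℂ) : Prop where
  continuousOn : ContinuousOn v (Icc a b)
  contDiffOn : ContDiffOn ℝ 2 v (Ioo a b)
  left : v a = 0
  right : v b = 0
  nontrivial : ∃ y ∈ Ioo a b, v y ≠ 0
  rayleigh : ∀ y ∈ Ioo a b, (k₁ * U y + k₃ * W y - σ : ℂ) ≠ 0 →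
    deriv (deriv v) y
        - (k₁ * deriv (deriv U) y + k₃ * deriv (deriv W) y : ℂ) / (k₁ * U y + k₃ * W y - σ) * v y
      = (k₁ ^ 2 + k₃ ^ 2 : ℂ) * v y

/-- The profile `U(y) = y`. -/
def profileU (y : ℝ) : ℝ := y

/-- The profile `W(y) = (A / n) sin(4 n π y)`. -/
def profileW (A : ℝ) (n : ℕ) (y : ℝ) : ℝ := A / n * Real.sin (4 * n * Real.pi * y)

end

/-!
Put `κ = k₃ / k₁`, `m = 4 n π`, `b = 4 π A κ` and `t = m (y - 1 / 2)`. In the direction of the wave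
vector the flow is `y + κ W_n(y) = 1 / 2 + (t + b sin t) / m`, so with `k₁² + k₃² = m² μ` and
`σ = k₁ (1 / 2 + i γ / m)` equation (R) becomes, on `[-T, T]` with `T = m / 2`,

  `w'' = (μ - b sin t / (t + b sin t - i γ)) w`,  `w (-T) = w T = 0`.

The parameter `n` only enters through `T`. The coefficient (`coeff`) satisfies
`q (-t) = conj (q t)`. Hence, if the solution on `[0, T]` with `w 0 = 1` and `w T = 0` has slope
`r = w' 0` with `Re r = 0`, then `w (-t) = conj (w t)` extends it to an eigenfunction, and unstable
modes are found by solving the single real equation `Re r (μ, γ, b) = 0` with `γ > 0`.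

At `γ = 0` the singularity at `t = 0` is removable. For `b = 3` the shear `t + b sin t` still has no
other zero, and the attractive potential is strong enough near `t = 0` for a Sturm comparison with
`cos (2 t / 3)` to give a neutral mode with some `μ₀ ≥ 1 / 50` (`exists_neutral`). As `μ₀` is bounded
below uniformly in `T`, so is `(k₁² + k₃²) / n²` along the neutral curve.

Near `(μ₀, 0, 3)` the function `Re r` is continuous up to `γ = 0`, because solutions depend on the
coefficient only through its `L¹` norm (`IsSol.norm_diff_le`). The Wronskian identity
`r₁ - r₂ = -∫ (q₁ - q₂) w₁ w₂` (`slopeAt_sub_slopeAt`) shows that it is strictly decreasing in `μ` at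
`γ = 0` (`slopeAt_lt_of_lt`), and strictly decreasing in `γ ≥ 0` (`slopeAt_lt_of_growth_lt`): the
kernel of the difference quotient in `γ` has an even part that concentrates at `t = 0` with positive
mass, as in the Plemelj formula, and a principal-value part that only sees the small odd part of
`w₁ w₂`. A function with these monotonicity properties has as zero set a surface over the region
below the curve of neutral modes, with `γ → 0` at the curve (`exists_zero_surface`). Finally the
velocity and pressure of a three-dimensional Euler mode are recovered from `v` by Squire's formulas
(`linearlyUnstable_of_rayleigh`).
-/

/-! ### Global solutions of Lipschitz differential equations -/

/-- A globally Lipschitz equation `x' = F(t, x)` is solvable on all of `[0, T]`. The solution is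
extended beyond the interval so that its derivatives at the endpoints are two-sided. -/
theorem exists_forall_hasDerivAt_of_lipschitz {E : Type*} [NormedAddCommGroup E] [NormedSpace ℝ E]
    [CompleteSpace E] {F : ℝ → E → E} (hF : Continuous fun z : ℝ × E => F z.1 z.2) {M T : ℝ}
    (hM : 0 < M) (hT : 0 ≤ T)
    (hL : ∀ t ∈ Icc 0 T, ∀ x y, ‖F t x - F t y‖ ≤ M * ‖x - y‖) (x₀ : E) :
    ∃ x : ℝ → E, x 0 = x₀ ∧ ∀ t ∈ Icc 0 T, HasDerivAt x (F t (x t)) t := by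
  -- the exponential weight makes the Picard map a contraction on an interval of any length
  set c : ℝ := 2 * M with hc
  have hcpos : 0 < c := by positivity
  let ext : C(Icc (0 : ℝ) T, E) → ℝ → E := fun y s =>
    F s (Real.exp (c * s) • y (projIcc 0 T hT s))
  have hext : ∀ y, Continuous (ext y) := fun y => by
    have : Continuous fun s : ℝ => (s, Real.exp (c * s) • y (projIcc 0 T hT s)) := by
      have := y.continuous.comp (continuous_projIcc (a := (0 : ℝ)) (b := T) (h := hT))
      fun_prop
    exact hF.comp this
  let X : C(Icc (0 : ℝ) T, E) → ℝ → E := fun y t => x₀ + ∫ s in (0 : ℝ)..t, ext y s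
  have hX : ∀ y t, HasDerivAt (X y) (ext y t) t := fun y t =>
    ((hext y).integral_hasStrictDerivAt 0 t).hasDerivAt.const_add x₀
  let Φ : C(Icc (0 : ℝ) T, E) → C(Icc (0 : ℝ) T, E) := fun y =>
    ⟨fun t => Real.exp (-c * t) • X y t, by
      have : Continuous (X y) := continuous_iff_continuousAt.2 fun t => (hX y t).continuousAt
      fun_prop⟩
  have hΦ : ContractingWith (1 / 2) Φ := by
    refine ⟨by
      rw [← NNReal.coe_lt_coe]
      norm_num, LipschitzWith.of_dist_le_mul fun y₁ y₂ => ?_⟩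
    rw [ContinuousMap.dist_le (by positivity)]
    rintro ⟨t, ht⟩
    have hdiff : X y₁ t - X y₂ t = ∫ s in (0 : ℝ)..t, (ext y₁ s - ext y₂ s) := by
      simp only [X]
      rw [intervalIntegral.integral_sub ((hext _).intervalIntegrable _ _)
        ((hext _).intervalIntegrable _ _)]
      abel
    have hbd : ‖∫ s in (0 : ℝ)..t, (ext y₁ s - ext y₂ s)‖
        ≤ ∫ s in (0 : ℝ)..t, M * dist y₁ y₂ * Real.exp (c * s) := by
      refine intervalIntegral.norm_integral_le_of_norm_le ht.1 ?_ ?_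
      · refine Eventually.of_forall fun s hs => ?_
        have hs' : s ∈ Icc 0 T := ⟨hs.1.le, hs.2.trans ht.2⟩
        refine (hL s hs' _ _).trans ?_
        rw [← smul_sub, norm_smul, Real.norm_of_nonneg (Real.exp_pos _).le, ← dist_eq_norm]
        have := ContinuousMap.dist_apply_le_dist (f := y₁) (g := y₂) (projIcc 0 T hT s)
        calc M * (Real.exp (c * s) * dist (y₁ (projIcc 0 T hT s)) (y₂ (projIcc 0 T hT s)))
            ≤ M * (Real.exp (c * s) * dist y₁ y₂) := by gcongr
          _ = _ := by ring
      · exact Continuous.intervalIntegrable (by fun_prop) _ _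
    have hval : ∫ s in (0 : ℝ)..t, M * dist y₁ y₂ * Real.exp (c * s)
        = M * dist y₁ y₂ * ((Real.exp (c * t) - 1) / c) := by
      rw [intervalIntegral.integral_const_mul, intervalIntegral.integral_comp_mul_left _ hcpos.ne']
      rw [integral_exp, mul_zero, Real.exp_zero, smul_eq_mul, div_eq_inv_mul]
    have h1 : dist (Φ y₁ ⟨t, ht⟩) (Φ y₂ ⟨t, ht⟩)
        = Real.exp (-c * t) * ‖∫ s in (0 : ℝ)..t, (ext y₁ s - ext y₂ s)‖ := by
      simp only [Φ, ContinuousMap.coe_mk, dist_eq_norm]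
      rw [← smul_sub, norm_smul, Real.norm_of_nonneg (Real.exp_pos _).le, hdiff]
    rw [h1]
    have h2 : Real.exp (-c * t) * Real.exp (c * t) = 1 := by
      rw [← Real.exp_add]
      simp
    have h3 := Real.exp_pos (-c * t)
    calc Real.exp (-c * t) * ‖∫ s in (0 : ℝ)..t, (ext y₁ s - ext y₂ s)‖
        ≤ Real.exp (-c * t) * (M * dist y₁ y₂ * ((Real.exp (c * t) - 1) / c)) := by
          rw [← hval]
          gcongr
      _ = dist y₁ y₂ / 2 * (Real.exp (-c * t) * Real.exp (c * t) - Real.exp (-c * t)) := by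
          rw [hc]
          field_simp
      _ ≤ dist y₁ y₂ / 2 * 1 := by
          rw [h2]
          gcongr
          linarith
      _ = _ := by
          push_cast
          ring
  obtain ⟨y, hy⟩ : ∃ y, Φ y = y := ⟨_, hΦ.fixedPoint_isFixedPt⟩
  refine ⟨X y, by simp [X], fun t ht => ?_⟩
  have hyt : y ⟨t, ht⟩ = Real.exp (-c * t) • X y t := by
    conv_lhs => rw [← hy]
    rfl
  have : F t (X y t) = ext y t := by
    simp only [ext, projIcc_of_mem hT ht, hyt, smul_smul, ← Real.exp_add]
    simp
  rw [this]
  exact hX y t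

/-! ### Second-order linear equations on an interval -/

/-- `f` solves `f'' = q f` on `[0, T]`, with `f' = fd`; derivatives are two-sided, also at the
endpoints. -/
structure IsSol (q : ℝ → ℂ) (T : ℝ) (f fd : ℝ → ℂ) : Prop where
  deriv_fst : ∀ t ∈ Icc 0 T, HasDerivAt f (fd t) t
  deriv_snd : ∀ t ∈ Icc 0 T, HasDerivAt fd (q t * f t) t

theorem exists_isSol {q : ℝ → ℂ} (hq : Continuous q) {T : ℝ} (hT : 0 ≤ T) (a b : ℂ) :
    ∃ f fd : ℝ → ℂ, f 0 = a ∧ fd 0 = b ∧ IsSol q T f fd := by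
  obtain ⟨M, hM⟩ := isCompact_Icc.exists_bound_of_continuousOn (s := Icc 0 T) hq.continuousOn
  obtain ⟨x, hx0, hx⟩ := exists_forall_hasDerivAt_of_lipschitz (E := ℂ × ℂ)
    (F := fun t x => (x.2, q t * x.1)) (by fun_prop) (M := max 1 M) (T := T) (by positivity) hT
    (fun t ht x y => by
      rw [Prod.mk_sub_mk, Prod.norm_mk, ← mul_sub, norm_mul]
      have h1 : ‖x.1 - y.1‖ ≤ ‖x - y‖ := norm_fst_le (x - y)
      have h2 : ‖x.2 - y.2‖ ≤ ‖x - y‖ := norm_snd_le (x - y)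
      have h3 := hM t ht
      have h4 := le_max_left 1 M
      have h5 := le_max_right 1 M
      refine max_le ?_ ?_
      · nlinarith [norm_nonneg (x - y)]
      · exact mul_le_mul (h3.trans h5) h1 (norm_nonneg _) (by positivity)) (a, b)
  refine ⟨fun t => (x t).1, fun t => (x t).2, by simp [hx0], by simp [hx0], fun t ht => ?_,
    fun t ht => ?_⟩
  · exact hasFDerivAt_fst.comp_hasDerivAt t (hx t ht)
  · exact hasFDerivAt_snd.comp_hasDerivAt t (hx t ht)

namespace IsSol

variable {q q₁ q₂ : ℝ → ℂ} {T : ℝ} {f fd g gd : ℝ → ℂ}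

theorem continuousOn (h : IsSol q T f fd) : ContinuousOn f (Icc 0 T) := fun t ht =>
  (h.deriv_fst t ht).continuousAt.continuousWithinAt

theorem continuousOn_deriv (h : IsSol q T f fd) : ContinuousOn fd (Icc 0 T) := fun t ht =>
  (h.deriv_snd t ht).continuousAt.continuousWithinAt

theorem add (hf : IsSol q T f fd) (hg : IsSol q T g gd) :
    IsSol q T (fun t => f t + g t) (fun t => fd t + gd t) :=
  ⟨fun t ht => (hf.deriv_fst t ht).add (hg.deriv_fst t ht), fun t ht => by
    have := (hf.deriv_snd t ht).add (hg.deriv_snd t ht)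
    rwa [← mul_add] at this⟩

theorem const_mul (hf : IsSol q T f fd) (a : ℂ) :
    IsSol q T (fun t => a * f t) (fun t => a * fd t) :=
  ⟨fun t ht => (hf.deriv_fst t ht).const_mul a, fun t ht => by
    have := (hf.deriv_snd t ht).const_mul a
    rwa [mul_left_comm] at this⟩

theorem conj (hf : IsSol q T f fd) :
    IsSol (fun t => starRingEnd ℂ (q t)) T (fun t => starRingEnd ℂ (f t))
      (fun t => starRingEnd ℂ (fd t)) := by
  refine ⟨fun t ht => ?_, fun t ht => ?_⟩
  · exact (hf.deriv_fst t ht).star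
  · have := (hf.deriv_snd t ht).star
    simpa [mul_comm] using this

/-- Exponential a priori bound. -/
theorem norm_le (h : IsSol q T f fd) {M D : ℝ} (hM : 1 ≤ M) (hq : ∀ t ∈ Icc 0 T, ‖q t‖ ≤ M)
    (h0 : ‖f 0‖ ≤ D) (h0' : ‖fd 0‖ ≤ D) :
    ∀ t ∈ Icc 0 T, ‖f t‖ ≤ D * Real.exp (M * T) ∧ ‖fd t‖ ≤ D * Real.exp (M * T) := by
  have hD : 0 ≤ D := (norm_nonneg _).trans h0
  have key := norm_le_gronwallBound_of_norm_deriv_right_le (f := fun t => (f t, fd t))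
    (f' := fun t => (fd t, q t * f t)) (δ := D) (K := M) (ε := 0) (a := 0) (b := T)
    (h.continuousOn.prodMk h.continuousOn_deriv)
    (fun t ht => ((h.deriv_fst t ⟨ht.1, ht.2.le⟩).prodMk
      (h.deriv_snd t ⟨ht.1, ht.2.le⟩)).hasDerivWithinAt)
    (max_le h0 h0') (fun t ht => by
      rw [add_zero, Prod.norm_mk, Prod.norm_mk, norm_mul]
      have h3 := hq t ⟨ht.1, ht.2.le⟩
      refine max_le ?_ ?_
      · calc ‖fd t‖ = 1 * ‖fd t‖ := by ring
          _ ≤ M * max ‖f t‖ ‖fd t‖ := by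
            gcongr
            exact le_max_right _ _
      · gcongr
        exact le_max_left _ _)
  intro t ht
  have hk := key t ht
  rw [gronwallBound_ε0, sub_zero, Prod.norm_mk] at hk
  have hexp : D * Real.exp (M * t) ≤ D * Real.exp (M * T) := by
    gcongr
    exact ht.2
  exact ⟨(le_max_left _ _).trans (hk.trans hexp), (le_max_right _ _).trans (hk.trans hexp)⟩

theorem eq_zero (h : IsSol q T f fd) (hq : Continuous q) (h0 : f 0 = 0) (h0' : fd 0 = 0) :
    ∀ t ∈ Icc 0 T, f t = 0 ∧ fd t = 0 := by
  obtain ⟨M, hM⟩ := isCompact_Icc.exists_bound_of_continuousOn (s := Icc 0 T) hq.continuousOn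
  intro t ht
  have := h.norm_le (M := max 1 M) (D := 0) (le_max_left _ _)
    (fun t ht => (hM t ht).trans (le_max_right _ _)) (by simp [h0]) (by simp [h0']) t ht
  simpa using this

/-- A solution with real coefficient and real data is real. -/
theorem conj_eq (h : IsSol q T f fd) (hq : Continuous q) (hqr : ∀ t, starRingEnd ℂ (q t) = q t)
    (h0 : starRingEnd ℂ (f 0) = f 0) (h0' : starRingEnd ℂ (fd 0) = fd 0) :
    ∀ t ∈ Icc 0 T, starRingEnd ℂ (f t) = f t ∧ starRingEnd ℂ (fd t) = fd t := by
  have hc := h.conj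
  simp only [hqr] at hc
  have hd := (hc.add (h.const_mul (-1))).eq_zero hq (by simp [h0]) (by simp [h0'])
  intro t ht
  have := hd t ht
  exact ⟨by linear_combination this.1, by linear_combination this.2⟩

/-- The Wronskian of solutions for two coefficients. -/
theorem wronskian (hf : IsSol q₁ T f fd) (hg : IsSol q₂ T g gd) (hq₁ : Continuous q₁)
    (hq₂ : Continuous q₂) {t : ℝ} (ht : t ∈ Icc 0 T) :
    fd t * g t - f t * gd t
      = fd 0 * g 0 - f 0 * gd 0 + ∫ s in (0 : ℝ)..t, (q₁ s - q₂ s) * (f s * g s) := by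
  have hsub : uIcc 0 t ⊆ Icc 0 T := by
    rw [uIcc_of_le ht.1]
    exact Icc_subset_Icc_right ht.2
  have hderiv : ∀ s ∈ uIcc 0 t, HasDerivAt (fun s => fd s * g s - f s * gd s)
      ((q₁ s - q₂ s) * (f s * g s)) s := fun s hs => by
    have := ((hf.deriv_snd s (hsub hs)).mul (hg.deriv_fst s (hsub hs))).sub
      ((hf.deriv_fst s (hsub hs)).mul (hg.deriv_snd s (hsub hs)))
    refine this.congr_deriv ?_
    ring
  have hcont : ContinuousOn (fun s => (q₁ s - q₂ s) * (f s * g s)) (uIcc 0 t) :=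
    (hq₁.sub hq₂).continuousOn.mul ((hf.continuousOn.mono hsub).mul (hg.continuousOn.mono hsub))
  rw [intervalIntegral.integral_eq_sub_of_hasDerivAt hderiv hcont.intervalIntegrable]
  ring

/-- Solutions depend on the coefficient only through its `L¹` distance: the difference of two
solutions is expressed through Wronskians with a fundamental system. -/
theorem norm_diff_le (hf : IsSol q₁ T f fd) (hg : IsSol q₂ T g gd) (hq₁ : Continuous q₁)
    (hq₂ : Continuous q₂) (hT : 0 ≤ T) {M D : ℝ} (hM : 1 ≤ M) (hM₁ : ∀ t ∈ Icc 0 T, ‖q₁ t‖ ≤ M)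
    (hM₂ : ∀ t ∈ Icc 0 T, ‖q₂ t‖ ≤ M) (hD : ‖f 0‖ ≤ D) (hD' : ‖fd 0‖ ≤ D) {t : ℝ}
    (ht : t ∈ Icc 0 T) :
    ‖f t - g t‖ ≤ Real.exp (M * T) * (‖f 0 - g 0‖ + ‖fd 0 - gd 0‖
        + 2 * D * Real.exp (M * T) ^ 2 * ∫ s in (0 : ℝ)..T, ‖q₁ s - q₂ s‖) ∧
    ‖fd t - gd t‖ ≤ Real.exp (M * T) * (‖f 0 - g 0‖ + ‖fd 0 - gd 0‖
        + 2 * D * Real.exp (M * T) ^ 2 * ∫ s in (0 : ℝ)..T, ‖q₁ s - q₂ s‖) := by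
  -- as `χ ζ' - χ' ζ = 1`, the Wronskians of `f - g` with `χ` and `ζ` determine `f - g` and its
  -- derivative
  obtain ⟨χ, χd, h1, h2, hχ⟩ := exists_isSol hq₂ hT 1 0
  obtain ⟨ζ, ζd, h3, h4, hζ⟩ := exists_isSol hq₂ hT 0 1
  have hD0 : 0 ≤ D := (norm_nonneg _).trans hD
  set B := Real.exp (M * T) with hB
  have hB0 : 0 < B := Real.exp_pos _
  have bχ := hχ.norm_le (D := 1) hM hM₂ (by simp [h1]) (by simp [h2])
  have bζ := hζ.norm_le (D := 1) hM hM₂ (by simp [h3]) (by simp [h4])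
  have bf := hf.norm_le hM hM₁ hD hD'
  rw [← hB] at bχ bζ bf
  set E := ∫ s in (0 : ℝ)..T, ‖q₁ s - q₂ s‖ with hE
  have hint : ∀ {u ud : ℝ → ℂ}, IsSol q₂ T u ud → (∀ s ∈ Icc 0 T, ‖u s‖ ≤ 1 * B ∧ ‖ud s‖ ≤ 1 * B) →
      ‖∫ s in (0 : ℝ)..t, (q₁ s - q₂ s) * (f s * u s)‖ ≤ D * B ^ 2 * E := by
    intro u ud hu hb
    have hi : ∀ a b, IntervalIntegrable (fun s => D * B ^ 2 * ‖q₁ s - q₂ s‖)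
        MeasureTheory.volume a b := fun a b => Continuous.intervalIntegrable (by fun_prop) _ _
    calc ‖∫ s in (0 : ℝ)..t, (q₁ s - q₂ s) * (f s * u s)‖
        ≤ ∫ s in (0 : ℝ)..t, D * B ^ 2 * ‖q₁ s - q₂ s‖ := by
          refine intervalIntegral.norm_integral_le_of_norm_le ht.1 ?_ (hi _ _)
          refine Eventually.of_forall fun s hs => ?_
          have hs' : s ∈ Icc 0 T := ⟨hs.1.le, hs.2.trans ht.2⟩
          rw [norm_mul, norm_mul]
          have hb1 := (bf s hs').1
          have hb2 := (hb s hs').1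
          calc ‖q₁ s - q₂ s‖ * (‖f s‖ * ‖u s‖) ≤ ‖q₁ s - q₂ s‖ * ((D * B) * (1 * B)) := by gcongr
            _ = _ := by ring
      _ ≤ ∫ s in (0 : ℝ)..T, D * B ^ 2 * ‖q₁ s - q₂ s‖ := by
          refine intervalIntegral.integral_mono_interval le_rfl ht.1 ht.2 ?_ (hi _ _)
          exact Eventually.of_forall fun s => by positivity
      _ = _ := by rw [intervalIntegral.integral_const_mul]
  have wfχ := hf.wronskian hχ hq₁ hq₂ ht
  have wgχ := hg.wronskian hχ hq₂ hq₂ ht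
  have wfζ := hf.wronskian hζ hq₁ hq₂ ht
  have wgζ := hg.wronskian hζ hq₂ hq₂ ht
  have wζχ := hζ.wronskian hχ hq₂ hq₂ ht
  simp only [sub_self, zero_mul, intervalIntegral.integral_zero, add_zero, h1, h2, h3, h4, mul_one,
    mul_zero, sub_zero] at wfχ wgχ wfζ wgζ wζχ
  have iχ := hint hχ bχ
  have iζ := hint hζ bζ
  set Iχ := ∫ s in (0 : ℝ)..t, (q₁ s - q₂ s) * (f s * χ s)
  set Iζ := ∫ s in (0 : ℝ)..t, (q₁ s - q₂ s) * (f s * ζ s)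
  have e1 : f t - g t = ζ t * (fd 0 - gd 0 + Iχ) - χ t * (-(f 0 - g 0) + Iζ) := by
    linear_combination (-(f t - g t)) * wζχ + ζ t * wfχ - ζ t * wgχ - χ t * wfζ + χ t * wgζ
  have e2 : fd t - gd t = ζd t * (fd 0 - gd 0 + Iχ) - χd t * (-(f 0 - g 0) + Iζ) := by
    linear_combination (-(fd t - gd t)) * wζχ + ζd t * wfχ - ζd t * wgχ - χd t * wfζ + χd t * wgζ
  have nA : ‖fd 0 - gd 0 + Iχ‖ ≤ ‖fd 0 - gd 0‖ + D * B ^ 2 * E :=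
    (norm_add_le _ _).trans (by gcongr)
  have nB : ‖-(f 0 - g 0) + Iζ‖ ≤ ‖f 0 - g 0‖ + D * B ^ 2 * E :=
    (norm_add_le _ _).trans (by rw [norm_neg]; gcongr)
  obtain ⟨c1, c2⟩ := bχ t ht
  obtain ⟨c3, c4⟩ := bζ t ht
  have fin : ∀ z w : ℂ, ‖z‖ ≤ 1 * B → ‖w‖ ≤ 1 * B →
      ‖z * (fd 0 - gd 0 + Iχ) - w * (-(f 0 - g 0) + Iζ)‖
        ≤ B * (‖f 0 - g 0‖ + ‖fd 0 - gd 0‖ + 2 * D * B ^ 2 * E) := fun z w hz hw => by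
    refine (norm_sub_le _ _).trans ?_
    rw [norm_mul, norm_mul]
    calc _ ≤ (1 * B) * (‖fd 0 - gd 0‖ + D * B ^ 2 * E)
          + (1 * B) * (‖f 0 - g 0‖ + D * B ^ 2 * E) := by gcongr
      _ = _ := by ring
  rw [e1, e2]
  exact ⟨fin _ _ c3 c1, fin _ _ c4 c2⟩

/-- Continuous dependence: convergence of the coefficients in `L¹` and of the data implies uniform
convergence of the solutions and of their derivatives. -/
theorem eventually_norm_sub_le {ι : Type*} {l : Filter ι} {q : ι → ℝ → ℂ} {q₀ : ℝ → ℂ}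
    {f fd : ι → ℝ → ℂ} {f₀ fd₀ : ℝ → ℂ} {T M : ℝ} (hT : 0 ≤ T)
    (hq : ∀ᶠ i in l, Continuous (q i)) (hq₀ : Continuous q₀)
    (hM : ∀ᶠ i in l, ∀ t ∈ Icc 0 T, ‖q i t‖ ≤ M)
    (hf : ∀ᶠ i in l, IsSol (q i) T (f i) (fd i)) (hf₀ : IsSol q₀ T f₀ fd₀)
    (hint : Tendsto (fun i => ∫ s in (0 : ℝ)..T, ‖q i s - q₀ s‖) l (𝓝 0))
    (h0 : Tendsto (fun i => f i 0) l (𝓝 (f₀ 0))) (h0' : Tendsto (fun i => fd i 0) l (𝓝 (fd₀ 0)))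
    {ε : ℝ} (hε : 0 < ε) :
    ∀ᶠ i in l, ∀ t ∈ Icc 0 T, ‖f i t - f₀ t‖ ≤ ε ∧ ‖fd i t - fd₀ t‖ ≤ ε := by
  obtain ⟨M₀, hM₀⟩ := isCompact_Icc.exists_bound_of_continuousOn (s := Icc 0 T) hq₀.continuousOn
  set N := max 1 (max M M₀)
  set D := max ‖f₀ 0‖ ‖fd₀ 0‖ + 1
  set B := Real.exp (N * T)
  have hlim : Tendsto (fun i => B * (‖f i 0 - f₀ 0‖ + ‖fd i 0 - fd₀ 0‖
      + 2 * D * B ^ 2 * ∫ s in (0 : ℝ)..T, ‖q i s - q₀ s‖)) l (𝓝 0) := by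
    have h1 := (tendsto_iff_norm_sub_tendsto_zero.1 h0)
    have h2 := (tendsto_iff_norm_sub_tendsto_zero.1 h0')
    have := ((h1.add h2).add (hint.const_mul (2 * D * B ^ 2))).const_mul B
    simpa using this
  have hD : ∀ᶠ i in l, ‖f i 0‖ ≤ D := by
    refine (h0.norm.eventually_lt_const (u := D) ?_).mono fun _ h => h.le
    exact (le_max_left _ _).trans_lt (lt_add_one _)
  have hD' : ∀ᶠ i in l, ‖fd i 0‖ ≤ D := by
    refine (h0'.norm.eventually_lt_const (u := D) ?_).mono fun _ h => h.le
    exact (le_max_right _ _).trans_lt (lt_add_one _)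
  filter_upwards [hq, hM, hf, hD, hD', hlim.eventually_lt_const hε] with i hq hM hf hD hD' hlt t ht
  have := hf.norm_diff_le hf₀ hq hq₀ hT (M := N) (le_max_left _ _)
    (fun t ht => (hM t ht).trans ((le_max_left _ _).trans (le_max_right _ _)))
    (fun t ht => (hM₀ t ht).trans ((le_max_right _ _).trans (le_max_right _ _))) hD hD' ht
  exact ⟨this.1.trans hlt.le, this.2.trans hlt.le⟩

end IsSol

/-! ### The rescaled Rayleigh coefficient -/

/-- `sinc` is nonnegative on `[-π, π]` and at most `1 / π ≤ 1 / 3.14` in size elsewhere. -/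
theorem neg_inv_le_sinc (t : ℝ) : -(1 / 3.14) ≤ Real.sinc t := by
  wlog ht : 0 ≤ t generalizing t
  · rw [← Real.sinc_neg]
    exact this (-t) (by linarith)
  rcases le_or_gt t Real.pi with h | h
  · have : 0 ≤ Real.sinc t := by
      rcases ht.eq_or_lt with rfl | h0
      · simp
      · rw [Real.sinc_of_ne_zero h0.ne']
        exact div_nonneg (Real.sin_nonneg_of_nonneg_of_le_pi ht h) ht
    refine le_trans ?_ this
    norm_num
  · have hpi := Real.pi_gt_d2
    have h0 : 0 < t := by linarith
    rw [Real.sinc_of_ne_zero h0.ne', le_div_iff₀ h0]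
    have := Real.neg_one_le_sin t
    nlinarith

/-- The bound `b < 3.1 < π` keeps `t + b sin t` from vanishing at a second point. -/
theorem one_add_mul_sinc_pos {b : ℝ} (hb : b ∈ Ioo 0 3.1) (t : ℝ) :
    1 / 100 ≤ 1 + b * Real.sinc t := by
  have h := neg_inv_le_sinc t
  obtain ⟨h1, h2⟩ := hb
  have : b * (-(1 / 3.14)) ≤ b * Real.sinc t := by gcongr
  norm_num at this h2 ⊢
  linarith

theorem mul_sinc (t : ℝ) : t * Real.sinc t = Real.sin t := by
  rcases eq_or_ne t 0 with rfl | h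
  · simp
  · rw [Real.sinc_of_ne_zero h]
    field_simp

theorem contDiff_sinc : ContDiff ℝ ∞ Real.sinc := by
  rw [contDiff_iff_contDiffAt]
  intro t
  rcases eq_or_ne t 0 with rfl | h
  · rw [Real.sinc_eq_dslope]
    obtain ⟨p, hp⟩ := Real.analyticAt_sin (x := 0)
    exact (AnalyticAt.contDiffAt ⟨_, hp.has_fpower_series_dslope_fslope⟩)
  · have : Real.sinc =ᶠ[𝓝 t] fun s => Real.sin s / s := by
      filter_upwards [isOpen_ne.mem_nhds h] with s hs
      exact Real.sinc_of_ne_zero hs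
    refine ContDiffAt.congr_of_eventuallyEq ?_ this
    exact Real.contDiff_sin.contDiffAt.div contDiffAt_id h

/-- The coefficient of the rescaled Rayleigh equation `w'' = coeff μ γ b w`, where
`coeff μ γ b t = μ - b sin t / (t + b sin t - i γ)`. For `γ = 0` the removable singularity at
`t = 0` is filled in. -/
noncomputable def coeff (μ γ b t : ℝ) : ℂ :=
  μ - if γ = 0 then ((b * Real.sinc t / (1 + b * Real.sinc t) : ℝ) : ℂ)
    else (b * Real.sin t : ℂ) / (t + b * Real.sin t - γ * Complex.I)

/-- The scaled distance of the base flow from its value at the critical layer. -/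
noncomputable def shear (b t : ℝ) : ℝ := t + b * Real.sin t

theorem shear_eq (b t : ℝ) : shear b t = t * (1 + b * Real.sinc t) := by
  rw [shear, mul_add, mul_one, mul_left_comm, mul_sinc]

theorem shear_ne_zero {b : ℝ} (hb : b ∈ Ioo 0 3.1) {t : ℝ} (ht : t ≠ 0) : shear b t ≠ 0 := by
  rw [shear_eq]
  have := one_add_mul_sinc_pos hb t
  exact mul_ne_zero ht (by linarith)

theorem ofReal_sub_mul_I_ne_zero {x y : ℝ} (h : x ≠ 0 ∨ y ≠ 0) :
    (x - y * Complex.I : ℂ) ≠ 0 := by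
  intro h0
  have h1 := congrArg Complex.re h0
  have h2 := congrArg Complex.im h0
  simp at h1 h2
  tauto

theorem shear_sub_ne_zero {b : ℝ} (hb : b ∈ Ioo 0 3.1) {γ t : ℝ} (h : t ≠ 0 ∨ γ ≠ 0) :
    (t + b * Real.sin t - γ * Complex.I : ℂ) ≠ 0 := by
  have := ofReal_sub_mul_I_ne_zero (x := shear b t) (y := γ) (h.imp_left (shear_ne_zero hb))
  simpa [shear] using this

theorem coeff_eq {b : ℝ} (μ : ℝ) {γ t : ℝ} (h : t ≠ 0 ∨ γ ≠ 0) :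
    coeff μ γ b t = μ - (b * Real.sin t : ℂ) / (t + b * Real.sin t - γ * Complex.I) := by
  rw [coeff]
  split_ifs with hγ
  · subst hγ
    have ht : t ≠ 0 := by simpa using h
    congr 1
    have e : b * Real.sinc t / (1 + b * Real.sinc t) = b * Real.sin t / (t + b * Real.sin t) := by
      rw [← mul_sinc t, ← mul_div_mul_left _ _ ht]
      ring_nf
    rw [e]
    push_cast
    simp
  · rfl

theorem coeff_zero_eq (μ b t : ℝ) :
    coeff μ 0 b t = ((μ - b * Real.sinc t / (1 + b * Real.sinc t) : ℝ) : ℂ) := by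
  simp [coeff]

theorem contDiff_coeff (μ γ : ℝ) {b : ℝ} (hb : b ∈ Ioo 0 3.1) : ContDiff ℝ ∞ (coeff μ γ b) := by
  by_cases hγ : γ = 0
  · subst hγ
    have : coeff μ 0 b = fun t => ((μ - b * Real.sinc t / (1 + b * Real.sinc t) : ℝ) : ℂ) :=
      funext fun t => coeff_zero_eq μ b t
    rw [this]
    refine Complex.ofRealCLM.contDiff.comp ?_
    refine contDiff_const.sub ((contDiff_const.mul contDiff_sinc).div
      (contDiff_const.add (contDiff_const.mul contDiff_sinc)) fun t => ?_)
    have := one_add_mul_sinc_pos hb t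
    linarith
  · have : coeff μ γ b = fun t : ℝ =>
        (μ - (b * (Real.sin t : ℂ)) / (t + b * (Real.sin t : ℂ) - γ * Complex.I) : ℂ) :=
      funext fun t => coeff_eq μ (Or.inr hγ)
    rw [this]
    have h1 : ContDiff ℝ ∞ fun t : ℝ => ((Real.sin t : ℝ) : ℂ) :=
      Complex.ofRealCLM.contDiff.comp Real.contDiff_sin
    have h2 : ContDiff ℝ ∞ fun t : ℝ => (t : ℂ) := Complex.ofRealCLM.contDiff
    simp only [div_eq_mul_inv]
    refine contDiff_const.sub ((contDiff_const.mul h1).mul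
      (((h2.add (contDiff_const.mul h1)).sub contDiff_const).inv fun t => ?_))
    exact shear_sub_ne_zero hb (Or.inr hγ)

theorem continuous_coeff (μ γ : ℝ) {b : ℝ} (hb : b ∈ Ioo 0 3.1) : Continuous (coeff μ γ b) :=
  (contDiff_coeff μ γ hb).continuous

theorem coeff_neg (μ γ b t : ℝ) : coeff μ γ b (-t) = starRingEnd ℂ (coeff μ γ b t) := by
  rw [coeff, coeff]
  split_ifs with h
  · rw [Real.sinc_neg, map_sub, Complex.conj_ofReal, Complex.conj_ofReal]
  · simp only [map_sub, map_div₀, map_mul, map_add, Complex.conj_ofReal, Complex.conj_I,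
      Real.sin_neg, Complex.ofReal_neg]
    rw [← neg_div_neg_eq]
    ring_nf

theorem norm_coeff_le (μ γ : ℝ) {b : ℝ} (hb : b ∈ Ioo 0 3.1) (t : ℝ) :
    ‖coeff μ γ b t‖ ≤ |μ| + 310 := by
  have hh := one_add_mul_sinc_pos hb t
  have hs := Real.abs_sinc_le_one t
  have key : |b * Real.sinc t / (1 + b * Real.sinc t)| ≤ 310 := by
    rw [abs_div, abs_of_pos (show 0 < 1 + b * Real.sinc t by linarith), div_le_iff₀ (by linarith),
      abs_mul, abs_of_pos hb.1]
    have h1 := hb.2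
    have : b * |Real.sinc t| ≤ 3.1 * 1 := by
      gcongr
    norm_num at this
    linarith
  rw [coeff]
  refine (norm_sub_le _ _).trans ?_
  rw [Complex.norm_real, Real.norm_eq_abs]
  gcongr
  split_ifs with hγ
  · rw [Complex.norm_real, Real.norm_eq_abs]
    exact key
  · rcases eq_or_ne t 0 with rfl | ht
    · simp
    refine le_trans ?_ key
    have e : b * Real.sinc t / (1 + b * Real.sinc t) = b * Real.sin t / shear b t := by
      rw [shear_eq, ← mul_sinc t, ← mul_div_mul_left _ _ ht]
      ring_nf
    rw [e, norm_div, abs_div]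
    have h1 : ‖(b * Real.sin t : ℂ)‖ = |b * Real.sin t| := by
      rw [← Complex.ofReal_mul, Complex.norm_real, Real.norm_eq_abs]
    rw [h1]
    have h2 : |shear b t| ≤ ‖(t + b * Real.sin t - γ * Complex.I : ℂ)‖ := by
      refine le_trans (le_of_eq ?_) (Complex.abs_re_le_norm _)
      simp [shear, -Complex.ofReal_sin]
    have h3 : 0 < |shear b t| := abs_pos.2 (shear_ne_zero hb ht)
    gcongr

theorem continuousAt_coeff {t : ℝ} (ht : t ≠ 0) {p₀ : ℝ × ℝ × ℝ} (hb : p₀.2.2 ∈ Ioo 0 3.1) :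
    ContinuousAt (fun p : ℝ × ℝ × ℝ => coeff p.1 p.2.1 p.2.2 t) p₀ := by
  have : (fun p : ℝ × ℝ × ℝ => coeff p.1 p.2.1 p.2.2 t) = fun p : ℝ × ℝ × ℝ =>
      (p.1 - (p.2.2 * Real.sin t : ℂ) / (t + p.2.2 * Real.sin t - p.2.1 * Complex.I) : ℂ) :=
    funext fun p => coeff_eq _ (Or.inl ht)
  rw [this]
  refine ContinuousAt.sub (by fun_prop) (ContinuousAt.div (by fun_prop) (by fun_prop) ?_)
  exact shear_sub_ne_zero hb (Or.inl ht)

/-- The coefficient is continuous in the parameters in `L¹`. It is not so uniformly: for `γ ≠ 0` it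
equals `μ` at `t = 0`, which fails for `γ = 0`. -/
theorem tendsto_integral_coeff (T : ℝ) {p₀ : ℝ × ℝ × ℝ} (hb : p₀.2.2 ∈ Ioo 0 3.1) :
    Tendsto (fun p : ℝ × ℝ × ℝ => ∫ t in (0 : ℝ)..T,
      ‖coeff p.1 p.2.1 p.2.2 t - coeff p₀.1 p₀.2.1 p₀.2.2 t‖) (𝓝 p₀) (𝓝 0) := by
  have hev : ∀ᶠ p : ℝ × ℝ × ℝ in 𝓝 p₀, p.2.2 ∈ Ioo 0 3.1 ∧ |p.1| ≤ |p₀.1| + 1 := by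
    refine Eventually.and ?_ ?_
    · exact (continuous_snd.snd.continuousAt (x := p₀)).eventually (isOpen_Ioo.mem_nhds hb)
    · refine ((continuous_fst.abs.continuousAt (x := p₀)).eventually_lt continuousAt_const
        (lt_add_one _)).mono fun _ h => h.le
  have := intervalIntegral.continuousAt_of_dominated_interval (μ := MeasureTheory.volume)
    (F := fun (p : ℝ × ℝ × ℝ) t => ‖coeff p.1 p.2.1 p.2.2 t - coeff p₀.1 p₀.2.1 p₀.2.2 t‖)
    (x₀ := p₀) (bound := fun _ => (|p₀.1| + 1 + 310) + (|p₀.1| + 310)) (a := 0) (b := T)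
    (by
      filter_upwards [hev] with p hp
      exact ((continuous_coeff _ _ hp.1).sub (continuous_coeff _ _ hb)).norm.aestronglyMeasurable)
    (by
      filter_upwards [hev] with p hp
      refine Eventually.of_forall fun t _ => ?_
      rw [norm_norm]
      refine (norm_sub_le _ _).trans (add_le_add ((norm_coeff_le _ _ hp.1 t).trans ?_)
        (norm_coeff_le _ _ hb t))
      linarith [hp.2])
    intervalIntegrable_const
    (by
      have : ∀ᵐ t : ℝ, t ≠ 0 := by
        simp [MeasureTheory.ae_iff, MeasureTheory.measure_singleton]
      filter_upwards [this] with t ht _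
      exact ((continuousAt_coeff ht hb).sub continuousAt_const).norm)
  simpa [ContinuousAt] using this

theorem coeff_sub_coeff {b : ℝ} (hb : b ∈ Ioo 0 3.1) (μ γ₁ γ₂ : ℝ) {t : ℝ} (ht : t ≠ 0) :
    coeff μ γ₁ b t - coeff μ γ₂ b t = -(Complex.I * (γ₁ - γ₂)) * ((b * Real.sin t : ℂ)
      / ((shear b t - γ₁ * Complex.I) * (shear b t - γ₂ * Complex.I))) := by
  rw [coeff_eq μ (Or.inl ht), coeff_eq μ (Or.inl ht)]
  have h1 := ofReal_sub_mul_I_ne_zero (y := γ₁) (Or.inl (shear_ne_zero hb ht))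
  have h2 := ofReal_sub_mul_I_ne_zero (y := γ₂) (Or.inl (shear_ne_zero hb ht))
  have e : (t + b * Real.sin t : ℂ) = shear b t := by simp [shear]
  rw [e]
  have hd : (Complex.I * (γ₁ - γ₂) : ℂ)
      = (shear b t - γ₂ * Complex.I) - (shear b t - γ₁ * Complex.I) := by ring
  rw [hd]
  generalize (shear b t - γ₁ * Complex.I : ℂ) = z₁ at *
  generalize (shear b t - γ₂ * Complex.I : ℂ) = z₂ at *
  field_simp
  ring

/-! ### Shooting solutions and their dependence on the parameters -/

/-- The solution on `[0, T]` of `f'' = q f` with `f 0 = a` and `f' 0 = b`, paired with its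
derivative. -/
noncomputable def shoot (q : ℝ → ℂ) (T : ℝ) (a b : ℂ) : (ℝ → ℂ) × (ℝ → ℂ) :=
  Classical.epsilon fun f => f.1 0 = a ∧ f.2 0 = b ∧ IsSol q T f.1 f.2

theorem shoot_spec {q : ℝ → ℂ} (hq : Continuous q) {T : ℝ} (hT : 0 ≤ T) (a b : ℂ) :
    (shoot q T a b).1 0 = a ∧ (shoot q T a b).2 0 = b ∧
      IsSol q T (shoot q T a b).1 (shoot q T a b).2 := by
  obtain ⟨f, fd, h⟩ := exists_isSol hq hT a b
  exact Classical.epsilon_spec (p := fun f : (ℝ → ℂ) × (ℝ → ℂ) =>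
    f.1 0 = a ∧ f.2 0 = b ∧ IsSol q T f.1 f.2) ⟨(f, fd), h⟩

/-- The shooting solution of the rescaled Rayleigh equation with parameters `p = (μ, γ, b)`. -/
noncomputable def rayleighShoot (T : ℝ) (a b : ℂ) (p : ℝ × ℝ × ℝ) : (ℝ → ℂ) × (ℝ → ℂ) :=
  shoot (coeff p.1 p.2.1 p.2.2) T a b

section

variable {T : ℝ} {p p₀ : ℝ × ℝ × ℝ}

theorem eventually_mem_Ioo (hb : p₀.2.2 ∈ Ioo 0 3.1) :
    ∀ᶠ p : ℝ × ℝ × ℝ in 𝓝 p₀, p.2.2 ∈ Ioo 0 3.1 :=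
  (continuous_snd.snd.continuousAt (x := p₀)).eventually (isOpen_Ioo.mem_nhds hb)

theorem rayleighShoot_spec (hT : 0 ≤ T) (hb : p.2.2 ∈ Ioo 0 3.1) (a b : ℂ) :
    (rayleighShoot T a b p).1 0 = a ∧ (rayleighShoot T a b p).2 0 = b ∧
      IsSol (coeff p.1 p.2.1 p.2.2) T (rayleighShoot T a b p).1 (rayleighShoot T a b p).2 :=
  shoot_spec (continuous_coeff _ _ hb) hT a b

theorem eventually_norm_coeff_le (hb : p₀.2.2 ∈ Ioo 0 3.1) (T : ℝ) :
    ∀ᶠ p : ℝ × ℝ × ℝ in 𝓝 p₀, ∀ t ∈ Icc 0 T, ‖coeff p.1 p.2.1 p.2.2 t‖ ≤ |p₀.1| + 311 := by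
  have h : ∀ᶠ p : ℝ × ℝ × ℝ in 𝓝 p₀, |p.1| < |p₀.1| + 1 :=
    (continuous_fst.abs.continuousAt (x := p₀)).eventually_lt continuousAt_const (lt_add_one _)
  filter_upwards [h, eventually_mem_Ioo hb] with p h hp t _
  refine (norm_coeff_le _ _ hp t).trans ?_
  linarith

theorem eventually_rayleighShoot (hT : 0 ≤ T) (hb : p₀.2.2 ∈ Ioo 0 3.1) (a b : ℂ) {ε : ℝ}
    (hε : 0 < ε) : ∀ᶠ p in 𝓝 p₀, ∀ t ∈ Icc 0 T,
      ‖(rayleighShoot T a b p).1 t - (rayleighShoot T a b p₀).1 t‖ ≤ ε ∧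
      ‖(rayleighShoot T a b p).2 t - (rayleighShoot T a b p₀).2 t‖ ≤ ε := by
  have hev := eventually_mem_Ioo hb
  have h₀ := rayleighShoot_spec hT hb a b
  refine IsSol.eventually_norm_sub_le hT (hev.mono fun p hp => continuous_coeff _ _ hp)
    (continuous_coeff _ _ hb) (eventually_norm_coeff_le hb T)
    (hev.mono fun p hp => (rayleighShoot_spec hT hp a b).2.2) h₀.2.2
    (tendsto_integral_coeff T hb) ?_ ?_ hε
  · rw [h₀.1]
    exact tendsto_const_nhds.congr' (hev.mono fun p hp => (rayleighShoot_spec hT hp a b).1.symm)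
  · rw [h₀.2.1]
    exact tendsto_const_nhds.congr' (hev.mono fun p hp => (rayleighShoot_spec hT hp a b).2.1.symm)

theorem continuousAt_rayleighShoot (hT : 0 ≤ T) (hb : p₀.2.2 ∈ Ioo 0 3.1) (a b : ℂ) {t : ℝ}
    (ht : t ∈ Icc 0 T) : ContinuousAt (fun p => (rayleighShoot T a b p).1 t) p₀ := by
  rw [ContinuousAt, Metric.tendsto_nhds]
  intro ε hε
  filter_upwards [eventually_rayleighShoot hT hb a b (half_pos hε)] with p hp
  rw [dist_eq_norm]
  exact (hp t ht).1.trans_lt (half_lt_self hε)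

/-- The two fundamental solutions at `T` do not vanish together. -/
theorem rayleighShoot_wronskian (hT : 0 ≤ T) (hb : p.2.2 ∈ Ioo 0 3.1) {t : ℝ} (ht : t ∈ Icc 0 T) :
    (rayleighShoot T 0 1 p).2 t * (rayleighShoot T 1 0 p).1 t
      - (rayleighShoot T 0 1 p).1 t * (rayleighShoot T 1 0 p).2 t = 1 := by
  obtain ⟨h1, h2, hχ⟩ := rayleighShoot_spec hT hb 1 0
  obtain ⟨h3, h4, hζ⟩ := rayleighShoot_spec hT hb 0 1
  have := hζ.wronskian hχ (continuous_coeff _ _ hb) (continuous_coeff _ _ hb) ht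
  simpa [h1, h2, h3, h4] using this

/-- The slope `w'(0) / w(0)` of the solution of the rescaled Rayleigh equation that vanishes
at `T`. -/
noncomputable def slopeAt (T : ℝ) (p : ℝ × ℝ × ℝ) : ℂ :=
  -(rayleighShoot T 1 0 p).1 T / (rayleighShoot T 0 1 p).1 T

/-- The solution of the rescaled Rayleigh equation with value `1` at `0` and `0` at `T`, paired
with its derivative. -/
noncomputable def decay (T : ℝ) (p : ℝ × ℝ × ℝ) : (ℝ → ℂ) × (ℝ → ℂ) :=
  (fun t => (rayleighShoot T 1 0 p).1 t + slopeAt T p * (rayleighShoot T 0 1 p).1 t,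
    fun t => (rayleighShoot T 1 0 p).2 t + slopeAt T p * (rayleighShoot T 0 1 p).2 t)

theorem decay_spec (hT : 0 ≤ T) (hb : p.2.2 ∈ Ioo 0 3.1) (hp : (rayleighShoot T 0 1 p).1 T ≠ 0) :
    (decay T p).1 0 = 1 ∧ (decay T p).2 0 = slopeAt T p ∧ (decay T p).1 T = 0 ∧
      IsSol (coeff p.1 p.2.1 p.2.2) T (decay T p).1 (decay T p).2 := by
  obtain ⟨h1, h2, hχ⟩ := rayleighShoot_spec hT hb 1 0
  obtain ⟨h3, h4, hζ⟩ := rayleighShoot_spec hT hb 0 1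
  refine ⟨by simp [decay, h1, h3], by simp [decay, h2, h4], ?_, hχ.add (hζ.const_mul _)⟩
  simp only [decay, slopeAt]
  field_simp
  ring

theorem continuousAt_slopeAt (hT : 0 ≤ T) (hb : p₀.2.2 ∈ Ioo 0 3.1)
    (hp : (rayleighShoot T 0 1 p₀).1 T ≠ 0) : ContinuousAt (slopeAt T) p₀ :=
  (continuousAt_rayleighShoot hT hb 1 0 ⟨hT, le_rfl⟩).neg.div
    (continuousAt_rayleighShoot hT hb 0 1 ⟨hT, le_rfl⟩) hp

theorem eventually_decay (hT : 0 ≤ T) (hb : p₀.2.2 ∈ Ioo 0 3.1)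
    (hp : (rayleighShoot T 0 1 p₀).1 T ≠ 0) {ε : ℝ} (hε : 0 < ε) :
    ∀ᶠ p in 𝓝 p₀, p.2.2 ∈ Ioo 0 3.1 ∧ (rayleighShoot T 0 1 p).1 T ≠ 0 ∧ ∀ t ∈ Icc 0 T,
      ‖(decay T p).1 t - (decay T p₀).1 t‖ ≤ ε ∧ ‖(decay T p).2 t - (decay T p₀).2 t‖ ≤ ε := by
  have hev := eventually_mem_Ioo hb
  have hne : ∀ᶠ p in 𝓝 p₀, (rayleighShoot T 0 1 p).1 T ≠ 0 :=
    (continuousAt_rayleighShoot hT hb 0 1 ⟨hT, le_rfl⟩).eventually_ne hp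
  have hev' := hev.and hne
  have h₀ := decay_spec hT hb hp
  have := IsSol.eventually_norm_sub_le (f := fun p => (decay T p).1) (fd := fun p => (decay T p).2)
    hT (hev.mono fun p hp => continuous_coeff _ _ hp)
    (continuous_coeff _ _ hb) (eventually_norm_coeff_le hb T)
    (hev'.mono fun p hp => (decay_spec hT hp.1 hp.2).2.2.2) h₀.2.2.2
    (tendsto_integral_coeff T hb)
    (by
      rw [h₀.1]
      exact tendsto_const_nhds.congr' (hev'.mono fun p hp => (decay_spec hT hp.1 hp.2).1.symm))
    (by
      rw [h₀.2.1]
      exact (continuousAt_slopeAt hT hb hp).congr'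
        (hev'.mono fun p hp => (decay_spec hT hp.1 hp.2).2.1.symm)) hε
  filter_upwards [hev, hne, this] with p h1 h2 h3 using ⟨h1, h2, h3⟩

/-- The Wronskian identity comparing the slopes for two parameters. -/
theorem slopeAt_sub_slopeAt {p₁ p₂ : ℝ × ℝ × ℝ} (hT : 0 ≤ T) (hb₁ : p₁.2.2 ∈ Ioo 0 3.1)
    (hb₂ : p₂.2.2 ∈ Ioo 0 3.1) (hp₁ : (rayleighShoot T 0 1 p₁).1 T ≠ 0)
    (hp₂ : (rayleighShoot T 0 1 p₂).1 T ≠ 0) :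
    slopeAt T p₁ - slopeAt T p₂ = -∫ t in (0 : ℝ)..T,
      (coeff p₁.1 p₁.2.1 p₁.2.2 t - coeff p₂.1 p₂.2.1 p₂.2.2 t)
        * ((decay T p₁).1 t * (decay T p₂).1 t) := by
  obtain ⟨h1, h2, h3, h4⟩ := decay_spec hT hb₁ hp₁
  obtain ⟨k1, k2, k3, k4⟩ := decay_spec hT hb₂ hp₂
  have := h4.wronskian k4 (continuous_coeff _ _ hb₁) (continuous_coeff _ _ hb₂) ⟨hT, le_rfl⟩
  rw [h1, h2, h3, k1, k2, k3] at this
  linear_combination -this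

end

/-! ### Existence of a neutral mode -/

theorem le_of_hasDerivAt_nonneg {f f' : ℝ → ℝ} {a b : ℝ} (hab : a ≤ b)
    (hf : ∀ t ∈ Icc a b, HasDerivAt f (f' t) t) (hf' : ∀ t ∈ Icc a b, 0 ≤ f' t) : f a ≤ f b := by
  refine monotoneOn_of_deriv_nonneg (convex_Icc a b)
    (fun t ht => (hf t ht).continuousAt.continuousWithinAt)
    (fun t ht => (hf t (interior_subset ht)).differentiableAt.differentiableWithinAt)
    (fun t ht => ?_) (left_mem_Icc.2 hab) (right_mem_Icc.2 hab) hab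
  rw [(hf t (interior_subset ht)).deriv]
  exact hf' t (interior_subset ht)

theorem three_mem_Ioo : (3 : ℝ) ∈ Ioo (0 : ℝ) 3.1 := by norm_num

/-- The real part of the even solution at `γ = 0`, `b = 3`. -/
noncomputable def evenSol (T μ t : ℝ) : ℝ := ((rayleighShoot T 1 0 (μ, 0, 3)).1 t).re

/-- The derivative of `evenSol`. -/
noncomputable def evenSolDeriv (T μ t : ℝ) : ℝ := ((rayleighShoot T 1 0 (μ, 0, 3)).2 t).re

section

variable {T : ℝ}

theorem evenSol_spec (hT : 0 ≤ T) (μ : ℝ) : evenSol T μ 0 = 1 ∧ evenSolDeriv T μ 0 = 0 ∧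
    (∀ t ∈ Icc 0 T, HasDerivAt (evenSol T μ) (evenSolDeriv T μ t) t) ∧
    ∀ t ∈ Icc 0 T, HasDerivAt (evenSolDeriv T μ)
      ((μ - 3 * Real.sinc t / (1 + 3 * Real.sinc t)) * evenSol T μ t) t := by
  obtain ⟨h1, h2, h⟩ := rayleighShoot_spec (p := (μ, 0, 3)) hT three_mem_Ioo 1 0
  refine ⟨by simp [evenSol, h1], by simp [evenSolDeriv, h2], fun t ht => ?_, fun t ht => ?_⟩
  · exact Complex.reCLM.hasFDerivAt.comp_hasDerivAt t (h.deriv_fst t ht)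
  · refine (Complex.reCLM.hasFDerivAt.comp_hasDerivAt t (h.deriv_snd t ht)).congr_deriv ?_
    rw [Complex.reCLM_apply, coeff_zero_eq, Complex.re_ofReal_mul]
    rfl

/-- At `γ = 0` the even solution is real. -/
theorem evenSol_eq (hT : 0 ≤ T) (μ : ℝ) : ∀ t ∈ Icc 0 T,
    (rayleighShoot T 1 0 (μ, 0, 3)).1 t = evenSol T μ t ∧
    (rayleighShoot T 1 0 (μ, 0, 3)).2 t = evenSolDeriv T μ t := by
  obtain ⟨h1, h2, h⟩ := rayleighShoot_spec (p := (μ, 0, 3)) hT three_mem_Ioo 1 0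
  intro t ht
  have := h.conj_eq (continuous_coeff _ _ three_mem_Ioo)
    (fun t => by rw [coeff_zero_eq, Complex.conj_ofReal]) (by simp [h1]) (by simp [h2]) t ht
  exact ⟨(Complex.conj_eq_iff_re.1 this.1).symm, (Complex.conj_eq_iff_re.1 this.2).symm⟩

theorem eventually_evenSol (hT : 0 ≤ T) (μ₀ : ℝ) {ε : ℝ} (hε : 0 < ε) :
    ∀ᶠ μ in 𝓝 μ₀, ∀ t ∈ Icc 0 T, |evenSol T μ t - evenSol T μ₀ t| ≤ ε := by
  have hc : ContinuousAt (fun μ : ℝ => ((μ, 0, 3) : ℝ × ℝ × ℝ)) μ₀ := by fun_prop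
  filter_upwards [hc.eventually (eventually_rayleighShoot hT three_mem_Ioo 1 0 hε)] with μ h t ht
  refine le_trans ?_ (h t ht).1
  rw [evenSol, evenSol, ← Complex.sub_re]
  exact Complex.abs_re_le_norm _

/-- For `μ = 1` the coefficient is positive, so the square of the even solution is nondecreasing
and the solution never vanishes. -/
theorem evenSol_one_pos (hT : 0 ≤ T) : ∀ t ∈ Icc 0 T, 0 < evenSol T 1 t := by
  obtain ⟨h1, h2, h3, h4⟩ := evenSol_spec hT 1
  have hk : ∀ t, 0 ≤ 1 - 3 * Real.sinc t / (1 + 3 * Real.sinc t) := fun t => by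
    have := one_add_mul_sinc_pos three_mem_Ioo t
    rw [sub_nonneg, div_le_one (by linarith)]
    linarith
  have hprod : ∀ t ∈ Icc 0 T, 0 ≤ evenSol T 1 t * evenSolDeriv T 1 t := fun t ht => by
    have := le_of_hasDerivAt_nonneg (f := fun t => evenSol T 1 t * evenSolDeriv T 1 t) ht.1
      (fun s hs => (h3 s ⟨hs.1, hs.2.trans ht.2⟩).mul (h4 s ⟨hs.1, hs.2.trans ht.2⟩))
      (fun s _ => by
        have e1 := mul_nonneg (hk s) (sq_nonneg (evenSol T 1 s))
        have e2 := sq_nonneg (evenSolDeriv T 1 s)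
        nlinarith)
    simpa [h2] using this
  have hsq : ∀ t ∈ Icc 0 T, 1 ≤ evenSol T 1 t ^ 2 := fun t ht => by
    have := le_of_hasDerivAt_nonneg (f := fun t => evenSol T 1 t ^ 2) ht.1
      (fun s hs => (h3 s ⟨hs.1, hs.2.trans ht.2⟩).pow 2)
      (fun s hs => by
        have := hprod s ⟨hs.1, hs.2.trans ht.2⟩
        simp only [Nat.cast_ofNat, Nat.add_one_sub_one, pow_one]
        nlinarith)
    simpa [h1] using this
  intro t ht
  by_contra! hneg
  have hcont : ContinuousOn (evenSol T 1) (Icc 0 t) := fun s hs =>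
    (h3 s ⟨hs.1, hs.2.trans ht.2⟩).continuousAt.continuousWithinAt
  obtain ⟨s, hs, hs0⟩ := intermediate_value_Icc' ht.1 hcont ⟨hneg, by rw [h1]; norm_num⟩
  have := hsq s ⟨hs.1, hs.2.trans ht.2⟩
  rw [hs0] at this
  norm_num at this

/-- On `[0, 3π/4]`, where `cos (2 t / 3)` is nonnegative, the potential dominates `1/50 + (2/3)²`. -/
theorem potential_lower_bound {t : ℝ} (ht : t ∈ Icc 0 (3 * Real.pi / 4)) :
    1 / 50 + 4 / 9 ≤ 3 * Real.sinc t / (1 + 3 * Real.sinc t) := by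
  have hpi := Real.pi_gt_three
  have hpi' := Real.pi_lt_d2
  -- by concavity `sin` lies above its chord over `[0, 3π/4]`
  have hs : 0.29 ≤ Real.sinc t := by
    rcases ht.1.eq_or_lt with rfl | h0
    · norm_num
    rw [Real.sinc_of_ne_zero h0.ne', le_div_iff₀ h0]
    have ha : Real.sin (3 * Real.pi / 4) = √2 / 2 := by
      rw [← Real.sin_pi_div_four, ← Real.sin_pi_sub]
      ring_nf
    have hw : 0 ≤ 1 - t / (3 * Real.pi / 4) :=
      sub_nonneg.2 ((div_le_one (by linarith)).2 ht.2)
    have hw' : 0 ≤ t / (3 * Real.pi / 4) := by positivity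
    have hm : (0 : ℝ) ∈ Icc 0 Real.pi := ⟨le_rfl, by linarith⟩
    have hm' : 3 * Real.pi / 4 ∈ Icc 0 Real.pi := ⟨by linarith, by linarith⟩
    have hc := strictConcaveOn_sin_Icc.concaveOn.2 hm hm' hw hw' (by ring)
    simp only [smul_eq_mul, mul_zero, zero_add, Real.sin_zero, ha] at hc
    rw [div_mul_cancel₀ _ (by positivity)] at hc
    refine le_trans ?_ hc
    have h2 : 1.4 ≤ √2 := Real.le_sqrt_of_sq_le (by norm_num)
    rw [div_mul_eq_mul_div, le_div_iff₀ (by positivity)]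
    have : 0.29 * (3 * Real.pi / 4) ≤ √2 / 2 := by
      norm_num at hpi' h2 ⊢
      linarith
    nlinarith
  rw [le_div_iff₀ (by linarith)]
  norm_num at hs ⊢
  linarith

/-- Sturm comparison with `cos (2 t / 3)`: for small `μ` the even solution vanishes somewhere. -/
theorem evenSol_nonpos (hT : 3 * Real.pi / 4 ≤ T) : ∃ t ∈ Icc 0 T, evenSol T (1 / 50) t ≤ 0 := by
  have hpi := Real.pi_gt_three
  have hT0 : 0 ≤ T := by linarith
  by_contra! hpos
  obtain ⟨h1, h2, h3, h4⟩ := evenSol_spec hT0 (1 / 50)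
  have hη : ∀ t : ℝ, HasDerivAt (fun t => Real.cos (2 / 3 * t)) (-(2 / 3) * Real.sin (2 / 3 * t)) t :=
    fun t => by
      refine (((hasDerivAt_id t).const_mul (2 / 3 : ℝ)).cos).congr_deriv ?_
      simp only [id]
      ring
  have hη' : ∀ t : ℝ, HasDerivAt (fun t => -(2 / 3) * Real.sin (2 / 3 * t))
      (-(4 / 9) * Real.cos (2 / 3 * t)) t := fun t => by
    refine ((((hasDerivAt_id t).const_mul (2 / 3 : ℝ)).sin).const_mul (-(2 / 3) : ℝ)).congr_deriv ?_
    simp only [id]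
    ring
  have key := le_of_hasDerivAt_nonneg
    (f := fun t => evenSol T (1 / 50) t * (-(2 / 3) * Real.sin (2 / 3 * t))
      - evenSolDeriv T (1 / 50) t * Real.cos (2 / 3 * t))
    (a := 0) (b := 3 * Real.pi / 4) (by positivity)
    (fun t ht => ((h3 t ⟨ht.1, ht.2.trans hT⟩).mul (hη' t)).sub
      ((h4 t ⟨ht.1, ht.2.trans hT⟩).mul (hη t)))
    (fun t ht => by
      have hc : 0 ≤ Real.cos (2 / 3 * t) :=
        Real.cos_nonneg_of_neg_pi_div_two_le_of_le (by linarith [ht.1]) (by linarith [ht.2])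
      have hp := (hpos t ⟨ht.1, ht.2.trans hT⟩).le
      have hb := potential_lower_bound ht
      have := mul_nonneg (mul_nonneg hp hc) (sub_nonneg.2 hb)
      nlinarith)
  have e : 2 / 3 * (3 * Real.pi / 4) = Real.pi / 2 := by ring
  simp only [e, h1, h2, Real.sin_pi_div_two, Real.cos_pi_div_two, mul_zero, Real.sin_zero,
    zero_mul, sub_zero, mul_one] at key
  have := hpos (3 * Real.pi / 4) ⟨by positivity, hT⟩
  linarith

/-- There is a neutral mode at `b = 3`: at the parameter where the minimum of the even solution
over `[0, T]` passes through zero, the zero lies at the wall `T`, since an interior zero would be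
a double zero. -/
theorem exists_neutral (hT : 3 * Real.pi / 4 ≤ T) :
    ∃ μ : ℝ, 1 / 50 ≤ μ ∧ evenSol T μ T = 0 := by
  have hpi := Real.pi_gt_three
  have hT0 : 0 ≤ T := by linarith
  -- `U` and `V` are open and disjoint, so they cannot cover the connected interval `[1/50, 1]`
  let U : Set ℝ := {μ | ∀ t ∈ Icc 0 T, 0 < evenSol T μ t}
  let V : Set ℝ := {μ | ∃ t ∈ Icc 0 T, evenSol T μ t < 0}
  have hU : IsOpen U := by
    rw [isOpen_iff_mem_nhds]
    intro μ hμ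
    have hcont : ContinuousOn (evenSol T μ) (Icc 0 T) := fun s hs =>
      ((evenSol_spec hT0 μ).2.2.1 s hs).continuousAt.continuousWithinAt
    obtain ⟨s, hs, hmin⟩ := isCompact_Icc.exists_isMinOn (nonempty_Icc.2 hT0) hcont
    filter_upwards [eventually_evenSol hT0 μ (half_pos (hμ s hs))] with ν hν t ht
    have h1 := abs_le.1 (hν t ht)
    have h2 : evenSol T μ s ≤ evenSol T μ t := hmin ht
    have h3 := hμ s hs
    linarith
  have hV : IsOpen V := by
    rw [isOpen_iff_mem_nhds]
    rintro μ ⟨t, ht, hμ⟩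
    filter_upwards [eventually_evenSol hT0 μ (ε := -evenSol T μ t / 2) (by linarith)] with ν hν
    refine ⟨t, ht, ?_⟩
    have h1 := abs_le.1 (hν t ht)
    linarith
  obtain ⟨μ, hμ, hμU, hμV⟩ : ∃ μ : ℝ, 1 / 50 ≤ μ ∧ μ ∉ U ∧ μ ∉ V := by
    by_contra! h
    have hcov : Icc (1 / 50 : ℝ) 1 ⊆ U ∪ V := fun μ hμ => by
      by_cases hU : μ ∈ U
      · exact Or.inl hU
      · exact Or.inr (h μ hμ.1 hU)
    have hnU : (1 / 50 : ℝ) ∉ U := fun hU => by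
      obtain ⟨t, ht, hle⟩ := evenSol_nonpos hT
      exact absurd (hU t ht) hle.not_gt
    obtain ⟨μ, -, hμU, t, ht, hlt⟩ := isPreconnected_Icc U V hU hV hcov
      ⟨1, by norm_num, evenSol_one_pos hT0⟩ ⟨1 / 50, by norm_num, h _ le_rfl hnU⟩
    exact absurd (hμU t ht) hlt.not_gt
  refine ⟨μ, hμ, ?_⟩
  simp only [U, V, mem_ofPred_eq, not_forall, not_exists, not_and, not_lt] at hμU hμV
  obtain ⟨z, hz, hz0⟩ := hμU
  have hz0' : evenSol T μ z = 0 := le_antisymm hz0 (hμV z hz)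
  rcases hz.2.eq_or_lt with rfl | hzT
  · exact hz0'
  exfalso
  obtain ⟨h1, h2, h3, h4⟩ := evenSol_spec hT0 μ
  have hzpos : 0 < z := by
    refine lt_of_le_of_ne hz.1 fun h => ?_
    rw [← h, h1] at hz0'
    norm_num at hz0'
  have hmin : IsLocalMin (evenSol T μ) z := by
    filter_upwards [Ioo_mem_nhds hzpos hzT] with t ht
    rw [hz0']
    exact hμV t ⟨ht.1.le, ht.2.le⟩
  have hd : evenSolDeriv T μ z = 0 := hmin.hasDerivAt_eq_zero (h3 z hz)
  have hw := rayleighShoot_wronskian (p := (μ, 0, 3)) hT0 three_mem_Ioo hz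
  obtain ⟨e1, e2⟩ := evenSol_eq hT0 μ z hz
  rw [e1, e2, hz0', hd] at hw
  simp at hw

end

/-! ### Monotonicity of the slope near a neutral mode -/

theorem im_kernel {V : ℝ} (hV : V ≠ 0) (s γ₁ γ₂ : ℝ) :
    ((s : ℂ) / ((V - γ₁ * Complex.I) * (V - γ₂ * Complex.I))).im
      = s * V * (γ₁ + γ₂) / ((V ^ 2 + γ₁ ^ 2) * (V ^ 2 + γ₂ ^ 2)) := by
  have h1 : V ^ 2 + γ₁ ^ 2 ≠ 0 := by positivity
  have h2 : V ^ 2 + γ₂ ^ 2 ≠ 0 := by positivity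
  have n1 := ofReal_sub_mul_I_ne_zero (y := γ₁) (Or.inl hV)
  have n2 := ofReal_sub_mul_I_ne_zero (y := γ₂) (Or.inl hV)
  have e : (s : ℂ) / ((V - γ₁ * Complex.I) * (V - γ₂ * Complex.I))
      = ((s * (V ^ 2 - γ₁ * γ₂) / ((V ^ 2 + γ₁ ^ 2) * (V ^ 2 + γ₂ ^ 2)) : ℝ) : ℂ)
        + ((s * V * (γ₁ + γ₂) / ((V ^ 2 + γ₁ ^ 2) * (V ^ 2 + γ₂ ^ 2)) : ℝ) : ℂ) * Complex.I := by
    have c1 : (V ^ 2 + γ₁ ^ 2 : ℂ) ≠ 0 := by exact_mod_cast h1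
    have c2 : (V ^ 2 + γ₂ ^ 2 : ℂ) ≠ 0 := by exact_mod_cast h2
    rw [div_eq_iff (mul_ne_zero n1 n2)]
    push_cast
    rw [div_mul_eq_mul_div, ← add_div, div_mul_eq_mul_div, eq_div_iff (mul_ne_zero c1 c2)]
    have hI := Complex.I_sq
    linear_combination (s * (-V ^ 2 * γ₁ * γ₂ + γ₁ ^ 2 * γ₂ ^ 2 + V ^ 2 * (γ₁ + γ₂) ^ 2
      - V * (γ₁ + γ₂) * γ₁ * γ₂ * Complex.I) : ℂ) * hI
  rw [e, Complex.add_im, Complex.ofReal_im, Complex.mul_I_im, Complex.ofReal_re, zero_add]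

theorem norm_kernel_le {V : ℝ} (hV : 0 < V) (s γ₁ γ₂ : ℝ) :
    ‖(s : ℂ) / ((V - γ₁ * Complex.I) * (V - γ₂ * Complex.I))‖ ≤ |s| / V ^ 2 := by
  have h : ∀ γ : ℝ, V ≤ ‖(V - γ * Complex.I : ℂ)‖ := fun γ => by
    refine le_trans (le_of_eq ?_) (Complex.abs_re_le_norm _)
    simp [abs_of_pos hV]
  rw [norm_div, norm_mul, Complex.norm_real, Real.norm_eq_abs, pow_two]
  have h1 := h γ₁
  have h2 := h γ₂
  gcongr

theorem abs_mul_sin_le {b : ℝ} (hb : b ∈ Ioo 0 3.1) {t : ℝ} (ht : 0 < t) :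
    |b * Real.sin t| ≤ 310 * shear b t ∧ t / 100 ≤ shear b t := by
  have hh := one_add_mul_sinc_pos hb t
  have h1 : t * (1 / 100) ≤ shear b t := by
    rw [shear_eq]
    gcongr
  have h2 : |b * Real.sin t| ≤ 31 / 10 * t := by
    rw [abs_mul, abs_of_pos hb.1]
    have h3 : b ≤ 31 / 10 := hb.2.le.trans (by norm_num)
    have h4 := Real.abs_sin_lt_abs ht.ne'
    rw [abs_of_pos ht] at h4
    gcongr
  constructor <;> linarith

/-- Concentration of the kernel: it is of size `1 / γ₁` on `[γ₁, 2 γ₁]`. -/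
theorem im_kernel_lower_bound {b t γ₁ γ₂ : ℝ} (hb : b ∈ Ioo 0 3.1) (hb2 : 2 ≤ b) (ht : t ≤ 1)
    (hγ₂ : 0 ≤ γ₂) (hγ : γ₂ < γ₁) (h1 : γ₁ ≤ t) (h2 : t ≤ 2 * γ₁) :
    1 / (600 * γ₁) ≤ ((b * Real.sin t : ℝ) * shear b t * (γ₁ + γ₂))
      / ((shear b t ^ 2 + γ₁ ^ 2) * (shear b t ^ 2 + γ₂ ^ 2)) := by
  have hγ₁ : 0 < γ₁ := by linarith
  have ht0 : 0 < t := by linarith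
  have hsin : t ≤ b * Real.sin t := by
    have h := Real.mul_le_sin ht0.le (by linarith [Real.pi_gt_three])
    have h3 : 1 / 2 ≤ 2 / Real.pi := by
      rw [div_le_div_iff₀ (by norm_num) Real.pi_pos]
      linarith [Real.pi_lt_four]
    have h4 : 1 / 2 * t ≤ Real.sin t := le_trans (by gcongr) h
    nlinarith
  have hVlo : t ≤ shear b t := by
    rw [shear]
    linarith
  have hVhi : shear b t ≤ 41 / 10 * t := by
    have h4 : b ≤ 31 / 10 := hb.2.le.trans (by norm_num)
    have h5 : b * Real.sin t ≤ 31 / 10 * t :=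
      mul_le_mul h4 (Real.sin_lt ht0).le (pos_of_mul_pos_right (ht0.trans_le hsin) hb.1.le).le
        (by norm_num)
    rw [shear]
    linarith
  generalize shear b t = V at *
  generalize b * Real.sin t = s at *
  have hV : 0 < V := by linarith
  have hs : 0 < s := by linarith
  have d1 : V ^ 2 + γ₁ ^ 2 ≤ 69 * γ₁ ^ 2 := by nlinarith
  have d2 : V ^ 2 + γ₂ ^ 2 ≤ 2 * V ^ 2 := by nlinarith
  calc 1 / (600 * γ₁) ≤ t * V * γ₁ / ((69 * γ₁ ^ 2) * (2 * V ^ 2)) := by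
        rw [div_le_div_iff₀ (by positivity) (by positivity)]
        have : V * (V * γ₁ ^ 2) ≤ 41 / 10 * t * (V * γ₁ ^ 2) := by gcongr
        have h6 : 0 ≤ t * (V * γ₁ ^ 2) := by positivity
        nlinarith
    _ ≤ _ := by
        gcongr
        linarith

section

variable {T : ℝ} {μ₀ : ℝ}

theorem decay_eq_evenSol (hT : 0 ≤ T) (h0 : evenSol T μ₀ T = 0) :
    slopeAt T (μ₀, 0, 3) = 0 ∧ (rayleighShoot T 0 1 (μ₀, 0, 3)).1 T ≠ 0 ∧
      ∀ t ∈ Icc 0 T, (decay T (μ₀, 0, 3)).1 t = evenSol T μ₀ t := by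
  have e := (evenSol_eq hT μ₀ T ⟨hT, le_rfl⟩).1
  rw [h0, Complex.ofReal_zero] at e
  have hs : slopeAt T (μ₀, 0, 3) = 0 := by rw [slopeAt, e, neg_zero, zero_div]
  refine ⟨hs, fun hz => ?_, fun t ht => ?_⟩
  · have := rayleighShoot_wronskian (p := (μ₀, 0, 3)) hT three_mem_Ioo ⟨hT, le_rfl⟩
    rw [e, hz] at this
    simp at this
  · simp only [decay, hs, zero_mul, add_zero]
    exact (evenSol_eq hT μ₀ t ht).1

/-- Near a neutral mode, products of decaying solutions differ from the square of the neutral mode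
by `O(ε t)`: both factors converge in `C¹` and all of them equal `1` at `t = 0`. -/
theorem norm_decay_mul_decay_sub_le (hT : 0 ≤ T) (h0 : evenSol T μ₀ T = 0) {ε : ℝ} (hε : 0 < ε) :
    ∀ᶠ z : (ℝ × ℝ × ℝ) × (ℝ × ℝ × ℝ) in 𝓝 ((μ₀, 0, 3), (μ₀, 0, 3)), ∀ t ∈ Icc 0 T,
      ‖(decay T z.1).1 t * (decay T z.2).1 t - (evenSol T μ₀ t : ℂ) ^ 2‖ ≤ ε * t := by
  obtain ⟨hs, hζ, hd⟩ := decay_eq_evenSol hT h0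
  obtain ⟨k1, k2, k3, k4⟩ := decay_spec (p := (μ₀, 0, 3)) hT three_mem_Ioo hζ
  obtain ⟨B₁, hB₁⟩ := isCompact_Icc.exists_bound_of_continuousOn k4.continuousOn
  obtain ⟨B₂, hB₂⟩ := isCompact_Icc.exists_bound_of_continuousOn k4.continuousOn_deriv
  set B := max 0 (max B₁ B₂)
  have hB : 0 ≤ B := le_max_left _ _
  set η := min 1 (ε / (2 * (2 * B + 1))) with hη_def
  have hη : 0 < η := by positivity
  have hη1 : η ≤ 1 := min_le_left _ _
  have hη2 : 2 * (η * (2 * B + 1)) ≤ ε := by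
    have := min_le_right 1 (ε / (2 * (2 * B + 1)))
    rw [← hη_def, le_div_iff₀ (by positivity)] at this
    linarith
  have hev := eventually_decay (p₀ := (μ₀, 0, 3)) hT three_mem_Ioo hζ hη
  rw [nhds_prod_eq]
  filter_upwards [hev.prod_mk hev] with z ⟨⟨hb₁, hz₁, hc₁⟩, ⟨hb₂, hz₂, hc₂⟩⟩ t ht
  obtain ⟨l1, l2, l3, l4⟩ := decay_spec hT hb₁ hz₁
  obtain ⟨m1, m2, m3, m4⟩ := decay_spec hT hb₂ hz₂
  have key := norm_image_sub_le_of_norm_deriv_le_segment' (a := 0) (b := T) (C := ε)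
    (f := fun t => (decay T z.1).1 t * (decay T z.2).1 t
      - (decay T (μ₀, 0, 3)).1 t * (decay T (μ₀, 0, 3)).1 t)
    (fun s hs => (((l4.deriv_fst s hs).mul (m4.deriv_fst s hs)).sub
      ((k4.deriv_fst s hs).mul (k4.deriv_fst s hs))).hasDerivWithinAt)
    (fun s hs => by
      have hs' : s ∈ Icc 0 T := ⟨hs.1, hs.2.le⟩
      obtain ⟨c1, c2⟩ := hc₁ s hs'
      obtain ⟨c3, c4⟩ := hc₂ s hs'
      have b1 : ‖(decay T (μ₀, 0, 3)).1 s‖ ≤ B :=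
        (hB₁ s hs').trans ((le_max_left _ _).trans (le_max_right _ _))
      have b2 : ‖(decay T (μ₀, 0, 3)).2 s‖ ≤ B :=
        (hB₂ s hs').trans ((le_max_right _ _).trans (le_max_right _ _))
      generalize (decay T (μ₀, 0, 3)).1 s = u at *
      generalize (decay T (μ₀, 0, 3)).2 s = v at *
      generalize (decay T z.1).1 s = u₁ at *
      generalize (decay T z.1).2 s = v₁ at *
      generalize (decay T z.2).1 s = u₂ at *
      generalize (decay T z.2).2 s = v₂ at *
      have hu₂ : ‖u₂‖ ≤ B + 1 := by
        calc ‖u₂‖ = ‖u + (u₂ - u)‖ := by ring_nf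
          _ ≤ ‖u‖ + ‖u₂ - u‖ := norm_add_le _ _
          _ ≤ B + 1 := by linarith
      have hu₁ : ‖u₁‖ ≤ B + 1 := by
        calc ‖u₁‖ = ‖u + (u₁ - u)‖ := by ring_nf
          _ ≤ ‖u‖ + ‖u₁ - u‖ := norm_add_le _ _
          _ ≤ B + 1 := by linarith
      have e : v₁ * u₂ + u₁ * v₂ - (v * u + u * v)
          = ((v₁ - v) * u₂ + v * (u₂ - u)) + (u₁ * (v₂ - v) + (u₁ - u) * v) := by ring
      rw [e]
      calc ‖((v₁ - v) * u₂ + v * (u₂ - u)) + (u₁ * (v₂ - v) + (u₁ - u) * v)‖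
          ≤ (‖v₁ - v‖ * ‖u₂‖ + ‖v‖ * ‖u₂ - u‖) + (‖u₁‖ * ‖v₂ - v‖ + ‖u₁ - u‖ * ‖v‖) := by
            refine (norm_add_le _ _).trans ?_
            refine add_le_add ((norm_add_le _ _).trans ?_) ((norm_add_le _ _).trans ?_) <;>
              simp only [norm_mul, le_refl]
        _ ≤ (η * (B + 1) + B * η) + ((B + 1) * η + η * B) := by gcongr
        _ = 2 * (η * (2 * B + 1)) := by ring
        _ ≤ ε := hη2) t ht
  simp only [l1, m1, k1, hd t ht, mul_one, sub_self, sub_zero] at key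
  rwa [pow_two]

theorem evenSol_sq_integral_pos (hT : 0 < T) : 0 < ∫ t in (0 : ℝ)..T, evenSol T μ₀ t ^ 2 := by
  obtain ⟨h1, h2, h3, h4⟩ := evenSol_spec hT.le μ₀
  have hc : ContinuousOn (evenSol T μ₀) (Icc 0 T) := fun s hs =>
    (h3 s hs).continuousAt.continuousWithinAt
  exact intervalIntegral.integral_pos hT (hc.pow 2) (fun t _ => sq_nonneg _)
    ⟨0, ⟨le_rfl, hT.le⟩, by rw [h1]; norm_num⟩

/-- At `γ = 0` the slope is strictly decreasing in `μ`. -/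
theorem slopeAt_lt_of_lt (hT : 0 < T) (h0 : evenSol T μ₀ T = 0) :
    ∀ᶠ z : (ℝ × ℝ × ℝ) × (ℝ × ℝ × ℝ) in 𝓝 ((μ₀, 0, 3), (μ₀, 0, 3)),
      z.1.2.1 = 0 → z.2.2.1 = 0 → z.1.2.2 = z.2.2.2 → z.1.1 < z.2.1 →
        (slopeAt T z.2).re < (slopeAt T z.1).re := by
  obtain ⟨hs, hζ, hd⟩ := decay_eq_evenSol hT.le h0
  have hI := evenSol_sq_integral_pos (μ₀ := μ₀) hT
  set I₀ := ∫ t in (0 : ℝ)..T, evenSol T μ₀ t ^ 2 with hI₀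
  have hev := eventually_decay (p₀ := (μ₀, 0, 3)) hT.le three_mem_Ioo hζ one_pos
  have hev2 := hev.prod_mk hev
  rw [← nhds_prod_eq] at hev2
  have hε : 0 < I₀ / (2 * T ^ 2) := by positivity
  filter_upwards [hev2, norm_decay_mul_decay_sub_le hT.le h0 hε]
    with z ⟨⟨hb₁, hz₁, hc₁⟩, ⟨hb₂, hz₂, hc₂⟩⟩ hg hγ₁ hγ₂ hb hlt
  obtain ⟨l1, l2, l3, l4⟩ := decay_spec hT.le hb₁ hz₁
  obtain ⟨m1, m2, m3, m4⟩ := decay_spec hT.le hb₂ hz₂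
  have key := slopeAt_sub_slopeAt hT.le hb₁ hb₂ hz₁ hz₂
  have hcf : ∀ t, coeff z.1.1 z.1.2.1 z.1.2.2 t - coeff z.2.1 z.2.2.1 z.2.2.2 t
      = ((z.1.1 - z.2.1 : ℝ) : ℂ) := fun t => by
    rw [hγ₁, hγ₂, hb, coeff_zero_eq, coeff_zero_eq, ← Complex.ofReal_sub]
    congr 1
    ring
  simp only [hcf] at key
  rw [intervalIntegral.integral_const_mul] at key
  have hreal : ((I₀ : ℝ) : ℂ) = ∫ t in (0 : ℝ)..T, (evenSol T μ₀ t : ℂ) ^ 2 := by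
    rw [hI₀, ← intervalIntegral.integral_ofReal]
    push_cast
    rfl
  obtain ⟨-, -, h3, -⟩ := evenSol_spec hT.le μ₀
  have hc : ContinuousOn (fun t => (evenSol T μ₀ t : ℂ) ^ 2) (Icc 0 T) := fun s hs =>
    ((Complex.continuous_ofReal.continuousAt.comp (h3 s hs).continuousAt).pow
      2).continuousWithinAt
  have hu : uIcc 0 T = Icc 0 T := uIcc_of_le hT.le
  have hdiff : ‖(∫ t in (0 : ℝ)..T, (decay T z.1).1 t * (decay T z.2).1 t) - I₀‖ ≤ I₀ / 2 := by
    rw [hreal, ← intervalIntegral.integral_sub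
      (ContinuousOn.intervalIntegrable (hu ▸ l4.continuousOn.mul m4.continuousOn))
      (ContinuousOn.intervalIntegrable (hu ▸ hc))]
    have := intervalIntegral.norm_integral_le_of_norm_le_const (a := 0) (b := T)
      (C := I₀ / (2 * T ^ 2) * T)
      (f := fun t => (decay T z.1).1 t * (decay T z.2).1 t - (evenSol T μ₀ t : ℂ) ^ 2)
      (fun t ht => by
        rw [uIoc_of_le hT.le] at ht
        refine (hg t ⟨ht.1.le, ht.2⟩).trans ?_
        have := ht.2
        gcongr)
    refine this.trans (le_of_eq ?_)
    rw [sub_zero, abs_of_pos hT]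
    field_simp
  have hre := (Complex.abs_re_le_norm _).trans hdiff
  rw [Complex.sub_re, Complex.ofReal_re, abs_le] at hre
  have kre := congrArg Complex.re key
  rw [Complex.sub_re, Complex.neg_re, Complex.re_ofReal_mul] at kre
  nlinarith

/-- The slope is strictly decreasing in `γ ≥ 0`. The kernel of the difference quotient concentrates
near the critical layer `t = 0`, where the neutral mode equals `1`. -/
theorem slopeAt_lt_of_growth_lt (hT : 0 < T) (h0 : evenSol T μ₀ T = 0) :
    ∀ᶠ z : (ℝ × ℝ × ℝ) × (ℝ × ℝ × ℝ) in 𝓝 ((μ₀, 0, 3), (μ₀, 0, 3)),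
      z.1.1 = z.2.1 → z.1.2.2 = z.2.2.2 → 0 ≤ z.2.2.1 → z.2.2.1 < z.1.2.1 →
        (slopeAt T z.1).re < (slopeAt T z.2).re := by
  obtain ⟨hs, hζ, hd⟩ := decay_eq_evenSol hT.le h0
  obtain ⟨w1, w2, w3, w4⟩ := evenSol_spec hT.le μ₀
  have hwc : ContinuousOn (evenSol T μ₀) (Icc 0 T) := fun s hs =>
    (w3 s hs).continuousAt.continuousWithinAt
  obtain ⟨B, hB⟩ := isCompact_Icc.exists_bound_of_continuousOn hwc
  have hB0 : 0 ≤ B := (norm_nonneg _).trans (hB 0 ⟨le_rfl, hT.le⟩)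
  -- a neighbourhood of the critical layer where the neutral mode is bounded below
  obtain ⟨τ, hτ0, hτ1, hτT, hτ⟩ : ∃ τ : ℝ, 0 < τ ∧ τ ≤ 1 ∧ τ ≤ T ∧
      ∀ t ∈ Icc 0 τ, 1 / 2 ≤ evenSol T μ₀ t ^ 2 := by
    have hcont : ContinuousAt (fun t => evenSol T μ₀ t ^ 2) 0 :=
      (w3 0 ⟨le_rfl, hT.le⟩).continuousAt.pow 2
    have hev := hcont.eventually (lt_mem_nhds (show (1 / 2 : ℝ) < evenSol T μ₀ 0 ^ 2 by
      rw [w1]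
      norm_num))
    obtain ⟨r, hr, hball⟩ := Metric.eventually_nhds_iff.1 hev
    refine ⟨min (r / 2) (min 1 T), by positivity, (min_le_right _ _).trans (min_le_left _ _),
      (min_le_right _ _).trans (min_le_right _ _), fun t ht => (hball ?_).le⟩
    have := ht.2.trans (min_le_left _ _)
    rw [Real.dist_eq, sub_zero, abs_of_nonneg ht.1]
    linarith
  -- the kernel is bounded by `31000 / t`, and on `[τ, T]` its imaginary part times the squared
  -- neutral mode is bounded by `C γ₁`; both errors integrate to at most `1 / 4800`, while the mass
  -- of the kernel near `t = 0` contributes at least `1 / 1200`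
  set ε : ℝ := 1 / (4800 * 31000 * T) with hε_def
  have hε : 0 < ε := by positivity
  set C : ℝ := 310 * 2 * 10000 / τ ^ 2 * B ^ 2 with hC_def
  have hC : 0 ≤ C := by positivity
  have hev := eventually_decay (p₀ := (μ₀, 0, 3)) hT.le three_mem_Ioo hζ one_pos
  have hev2 := hev.prod_mk hev
  rw [← nhds_prod_eq] at hev2
  have hsmall : ∀ᶠ z : (ℝ × ℝ × ℝ) × (ℝ × ℝ × ℝ) in 𝓝 ((μ₀, 0, 3), (μ₀, 0, 3)),
      z.1.2.1 < min (τ / 2) (1 / (4800 * T * (C + 1))) ∧ 2 < z.1.2.2 := by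
    refine Eventually.and ?_ ?_
    · exact (show Continuous fun z : (ℝ × ℝ × ℝ) × (ℝ × ℝ × ℝ) => z.1.2.1 by
        fun_prop).continuousAt.eventually_lt continuousAt_const (by positivity)
    · exact continuousAt_const.eventually_lt (show Continuous
        fun z : (ℝ × ℝ × ℝ) × (ℝ × ℝ × ℝ) => z.1.2.2 by fun_prop).continuousAt (by norm_num)
  filter_upwards [hev2, norm_decay_mul_decay_sub_le hT.le h0 hε, hsmall]
    with ⟨⟨μ, γ₁, b⟩, ⟨μ', γ₂, b'⟩⟩ ⟨⟨hb₁, hz₁, _⟩, ⟨hb₂, hz₂, _⟩⟩ hg ⟨hγs, hb2⟩ hμe hbe hγ₂ hγ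
  simp only at hb₁ hz₁ hb₂ hz₂ hg hγs hb2 hμe hbe hγ₂ hγ
  subst hμe hbe
  have hγ₁ : 0 < γ₁ := hγ₂.trans_lt hγ
  obtain ⟨hγτ, hγC⟩ := lt_min_iff.1 hγs
  obtain ⟨l1, l2, l3, l4⟩ := decay_spec hT.le hb₁ hz₁
  obtain ⟨m1, m2, m3, m4⟩ := decay_spec hT.le hb₂ hz₂
  have key := slopeAt_sub_slopeAt hT.le hb₁ hb₂ hz₁ hz₂
  simp only at key l4 m4
  set f : ℝ → ℂ := fun t => (decay T (μ, γ₁, b)).1 t * (decay T (μ, γ₂, b)).1 t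
  have hfc : ContinuousOn f (Icc 0 T) := l4.continuousOn.mul m4.continuousOn
  have hΔ : (-(Complex.I * (γ₁ - γ₂)) : ℂ) ≠ 0 := by
    have : (γ₁ - γ₂ : ℂ) ≠ 0 := by
      rw [← Complex.ofReal_sub]
      exact_mod_cast (sub_pos.2 hγ).ne'
    exact neg_ne_zero.2 (mul_ne_zero Complex.I_ne_zero this)
  -- the difference quotient of the coefficient, continuous also at `t = 0`
  set κ : ℝ → ℂ := fun t => (coeff μ γ₁ b t - coeff μ γ₂ b t) / (-(Complex.I * (γ₁ - γ₂)))
    with hκ_def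
  have hκc : Continuous κ := ((continuous_coeff _ _ hb₁).sub (continuous_coeff _ _ hb₁)).div_const _
  have hκ : ∀ t, 0 < t → κ t = ((b * Real.sin t : ℝ) : ℂ)
      / ((shear b t - γ₁ * Complex.I) * (shear b t - γ₂ * Complex.I)) := fun t ht => by
    rw [hκ_def]
    simp only
    rw [coeff_sub_coeff hb₁ _ _ _ ht.ne', mul_div_cancel_left₀ _ hΔ]
    push_cast
    rfl
  have hint : slopeAt T (μ, γ₁, b) - slopeAt T (μ, γ₂, b)
      = Complex.I * (γ₁ - γ₂) * ∫ t in (0 : ℝ)..T, κ t * f t := by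
    rw [key, ← intervalIntegral.integral_const_mul, ← intervalIntegral.integral_neg]
    congr 1
    ext t
    have : coeff μ γ₁ b t - coeff μ γ₂ b t = κ t * (-(Complex.I * (γ₁ - γ₂))) :=
      (div_mul_cancel₀ _ hΔ).symm
    rw [this]
    ring
  set e : ℝ := C * γ₁ + 31000 * ε with he_def
  have hdecomp : ∀ t ∈ Ioc 0 T,
      (κ t).im * evenSol T μ₀ t ^ 2 - 31000 * ε ≤ (κ t * f t).im := fun t ht => by
    have ht' : t ∈ Icc 0 T := ⟨ht.1.le, ht.2⟩
    obtain ⟨s1, s2⟩ := abs_mul_sin_le hb₁ ht.1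
    have hV : 0 < shear b t := lt_of_lt_of_le (by linarith [ht.1]) s2
    have e1 : κ t * f t = κ t * ((evenSol T μ₀ t ^ 2 : ℝ) : ℂ)
        + κ t * (f t - (evenSol T μ₀ t : ℂ) ^ 2) := by
      push_cast
      ring
    rw [e1, Complex.add_im, Complex.im_mul_ofReal]
    have h1 := (Complex.abs_im_le_norm (κ t * (f t - (evenSol T μ₀ t : ℂ) ^ 2)))
    have hn : ‖κ t‖ ≤ 31000 / t := by
      rw [hκ t ht.1]
      refine (norm_kernel_le hV _ _ _).trans ?_
      rw [div_le_div_iff₀ (by positivity) ht.1]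
      nlinarith [mul_le_mul_of_nonneg_left s2 hV.le, mul_le_mul_of_nonneg_right s1 ht.1.le]
    have h2 : ‖κ t * (f t - (evenSol T μ₀ t : ℂ) ^ 2)‖ ≤ 31000 * ε := by
      rw [norm_mul]
      have ht0 := ht.1
      calc _ ≤ 31000 / t * (ε * t) := by
            gcongr
            exact hg t ht'
        _ = 31000 * ε := by field_simp
    have := (abs_le.1 (h1.trans h2)).1
    linarith
  have hpos : ∀ t ∈ Ioc 0 T, 0 ≤ (κ t * f t).im + e := fun t ht => by
    have ht' : t ∈ Icc 0 T := ⟨ht.1.le, ht.2⟩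
    have h1 := hdecomp t ht
    obtain ⟨s1, s2⟩ := abs_mul_sin_le hb₁ ht.1
    have hV : 0 < shear b t := lt_of_lt_of_le (by linarith [ht.1]) s2
    have him := im_kernel hV.ne' (b * Real.sin t) γ₁ γ₂
    rw [← hκ t ht.1] at him
    suffices h2 : -(C * γ₁) ≤ (κ t).im * evenSol T μ₀ t ^ 2 by linarith
    rcases le_or_gt t τ with hle | hgt
    · have hsin : 0 ≤ Real.sin t := Real.sin_nonneg_of_nonneg_of_le_pi ht.1.le
        (by linarith [Real.pi_gt_three])
      have hb0 := hb₁.1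
      have : 0 ≤ (κ t).im := by
        rw [him]
        positivity
      have h3 := mul_nonneg this (sq_nonneg (evenSol T μ₀ t))
      have h4 := mul_nonneg hC hγ₁.le
      linarith
    · have hsq : evenSol T μ₀ t ^ 2 ≤ B ^ 2 := sq_le_sq' (by
        have := (abs_le.1 (hB t ht')).1
        exact this) (abs_le.1 (hB t ht')).2
      have hVτ : τ ^ 2 / 10000 ≤ shear b t ^ 2 := by
        have : τ / 100 ≤ shear b t := by linarith
        calc τ ^ 2 / 10000 = (τ / 100) ^ 2 := by ring
          _ ≤ _ := by gcongr
      have habs : |(κ t).im| ≤ 310 * 2 * 10000 / τ ^ 2 * γ₁ := by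
        rw [him, abs_div, abs_mul, abs_mul, abs_of_pos hV,
          abs_of_pos (show 0 < γ₁ + γ₂ by linarith),
          abs_of_pos (show 0 < (shear b t ^ 2 + γ₁ ^ 2) * (shear b t ^ 2 + γ₂ ^ 2) by positivity)]
        calc |b * Real.sin t| * shear b t * (γ₁ + γ₂)
              / ((shear b t ^ 2 + γ₁ ^ 2) * (shear b t ^ 2 + γ₂ ^ 2))
            ≤ (310 * shear b t) * shear b t * (γ₁ + γ₁)
              / ((shear b t ^ 2 + 0) * (τ ^ 2 / 10000 + 0)) := by
              gcongr <;> positivity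
          _ = _ := by
              field_simp
              ring
      have h3 := (abs_le.1 habs).1
      have h4 : |(κ t).im * evenSol T μ₀ t ^ 2| ≤ C * γ₁ := by
        rw [abs_mul, abs_of_nonneg (sq_nonneg (evenSol T μ₀ t))]
        calc _ ≤ 310 * 2 * 10000 / τ ^ 2 * γ₁ * B ^ 2 := by gcongr
          _ = _ := by
            rw [hC_def]
            ring
      exact (abs_le.1 h4).1
  have hmass : ∀ t ∈ Icc γ₁ (2 * γ₁), 1 / (1200 * γ₁) ≤ (κ t * f t).im + e := fun t ht => by
    have ht0 : 0 < t := hγ₁.trans_le ht.1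
    have htτ : t ≤ τ := by linarith [ht.2]
    have h1 := hdecomp t ⟨ht0, htτ.trans hτT⟩
    obtain ⟨s1, s2⟩ := abs_mul_sin_le hb₁ ht0
    have hV : 0 < shear b t := lt_of_lt_of_le (by linarith) s2
    have him := im_kernel hV.ne' (b * Real.sin t) γ₁ γ₂
    rw [← hκ t ht0] at him
    have hlow := im_kernel_lower_bound hb₁ hb2.le (htτ.trans hτ1) hγ₂ hγ ht.1 ht.2
    rw [← him] at hlow
    have h2 := hτ t ⟨ht0.le, htτ⟩
    have h3 : 1 / (600 * γ₁) * (1 / 2) ≤ (κ t).im * evenSol T μ₀ t ^ 2 := by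
      have : 0 ≤ 1 / (600 * γ₁) := by positivity
      gcongr
      linarith
    have h4 : 1 / (600 * γ₁) * (1 / 2) = 1 / (1200 * γ₁) := by
      field_simp
      norm_num
    have h5 := mul_nonneg hC hγ₁.le
    linarith
  have hNc : ContinuousOn (fun t => (κ t * f t).im + e) (Icc 0 T) :=
    (Complex.continuous_im.comp_continuousOn (hκc.continuousOn.mul hfc)).add continuousOn_const
  have hu : uIcc 0 T = Icc 0 T := uIcc_of_le hT.le
  have h2γ : 2 * γ₁ ≤ T := by linarith
  have hlow : 1 / 1200 ≤ ∫ t in (0 : ℝ)..T, ((κ t * f t).im + e) := by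
    calc (1 : ℝ) / 1200 = ∫ t in γ₁..2 * γ₁, 1 / (1200 * γ₁) := by
          rw [intervalIntegral.integral_const, smul_eq_mul]
          field_simp
          ring
      _ ≤ ∫ t in γ₁..2 * γ₁, ((κ t * f t).im + e) := by
          refine intervalIntegral.integral_mono_on (by linarith) intervalIntegrable_const ?_ hmass
          refine ContinuousOn.intervalIntegrable (hNc.mono ?_)
          rw [uIcc_of_le (by linarith)]
          exact Icc_subset_Icc hγ₁.le h2γ
      _ ≤ _ := by
          refine intervalIntegral.integral_mono_interval hγ₁.le (by linarith) h2γ ?_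
            (ContinuousOn.intervalIntegrable (hu ▸ hNc))
          exact (MeasureTheory.ae_restrict_iff' measurableSet_Ioc).2 (Eventually.of_forall hpos)
  have hκfi : IntervalIntegrable (fun t => κ t * f t) MeasureTheory.volume 0 T :=
    ContinuousOn.intervalIntegrable (hu ▸ hκc.continuousOn.mul hfc)
  have hImInt : (∫ t in (0 : ℝ)..T, κ t * f t).im = ∫ t in (0 : ℝ)..T, (κ t * f t).im :=
    (Complex.imCLM.intervalIntegral_comp_comm hκfi).symm
  rw [intervalIntegral.integral_add (ContinuousOn.intervalIntegrable (hu ▸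
    Complex.continuous_im.comp_continuousOn (hκc.continuousOn.mul hfc))) intervalIntegrable_const,
    intervalIntegral.integral_const, sub_zero, smul_eq_mul, ← hImInt] at hlow
  have heT : T * e ≤ 1 / 2400 := by
    have h1 : T * (31000 * ε) = 1 / 4800 := by
      rw [hε_def]
      field_simp
    have h2 : T * (C * γ₁) ≤ 1 / 4800 := by
      rw [lt_div_iff₀ (by positivity)] at hγC
      have : 0 ≤ T * γ₁ := by positivity
      nlinarith
    rw [he_def]
    linarith
  have hIm : 0 < (∫ t in (0 : ℝ)..T, κ t * f t).im := by linarith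
  have hre := congrArg Complex.re hint
  have e2 : Complex.I * (γ₁ - γ₂ : ℂ) = ((γ₁ - γ₂ : ℝ) : ℂ) * Complex.I := by
    push_cast
    ring
  rw [e2, mul_assoc, Complex.sub_re, Complex.re_ofReal_mul, Complex.I_mul_re] at hre
  have := mul_pos (sub_pos.2 hγ) hIm
  linarith

end

/-! ### A monotone implicit function theorem -/

/-- The zero of a strictly decreasing function depends continuously on parameters. -/
theorem continuousOn_of_strictAntiOn_zero {X : Type*} [TopologicalSpace X] {F : X → ℝ → ℝ}
    {S : Set X} {l u : ℝ} {g : X → ℝ} (hanti : ∀ x ∈ S, StrictAntiOn (F x) (Icc l u))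
    (hcont : ∀ x ∈ S, ∀ y ∈ Icc l u, ContinuousAt (fun x => F x y) x)
    (hg : ∀ x ∈ S, g x ∈ Ioo l u ∧ F x (g x) = 0) : ContinuousOn g S := by
  intro x hx
  obtain ⟨⟨hl, hu⟩, h0⟩ := hg x hx
  rw [ContinuousWithinAt, tendsto_order]
  refine ⟨fun y hy => ?_, fun y hy => ?_⟩
  · have hm : max y l ∈ Icc l u := ⟨le_max_right _ _, max_le (hy.le.trans hu.le) (hl.le.trans hu.le)⟩
    have hlt : 0 < F x (max y l) := by
      rw [← h0]
      exact hanti x hx hm ⟨hl.le, hu.le⟩ (max_lt hy hl)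
    have hev := ((hcont x hx _ hm).eventually (lt_mem_nhds hlt)).filter_mono
      (nhdsWithin_le_nhds (s := S))
    filter_upwards [hev, self_mem_nhdsWithin] with z hz hzS
    obtain ⟨⟨zl, zu⟩, z0⟩ := hg z hzS
    rw [← z0] at hz
    exact (le_max_left _ _).trans_lt
      (((hanti z hzS).lt_iff_gt ⟨zl.le, zu.le⟩ hm).1 hz)
  · have hm : min y u ∈ Icc l u := ⟨le_min (hl.le.trans hy.le) (hl.le.trans hu.le), min_le_right _ _⟩
    have hlt : F x (min y u) < 0 := by
      rw [← h0]
      exact hanti x hx ⟨hl.le, hu.le⟩ hm (lt_min hy hu)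
    have hev := ((hcont x hx _ hm).eventually (gt_mem_nhds hlt)).filter_mono
      (nhdsWithin_le_nhds (s := S))
    filter_upwards [hev, self_mem_nhdsWithin] with z hz hzS
    obtain ⟨⟨zl, zu⟩, z0⟩ := hg z hzS
    rw [← z0] at hz
    exact (((hanti z hzS).lt_iff_gt hm ⟨zl.le, zu.le⟩).1 hz).trans_le (min_le_left _ _)

/-- The region below the graph of `M` over the interval of radius `β` about `b₀`. -/
noncomputable def subgraph (μ₀ δ b₀ β : ℝ) (M : ℝ → ℝ) : Set (ℝ × ℝ) :=
  {x | x.2 ∈ Ioo (b₀ - β) (b₀ + β) ∧ μ₀ - δ < x.1 ∧ x.1 < M x.2}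

section

variable {μ₀ δ b₀ β : ℝ} {M : ℝ → ℝ}

theorem isOpen_subgraph (hM : ContinuousOn M (Ioo (b₀ - β) (b₀ + β))) :
    IsOpen (subgraph μ₀ δ b₀ β M) := by
  have h1 : IsOpen ((Prod.snd : ℝ × ℝ → ℝ) ⁻¹' Ioo (b₀ - β) (b₀ + β)) :=
    isOpen_Ioo.preimage continuous_snd
  have h2 : ContinuousOn (fun x : ℝ × ℝ => M x.2 - x.1)
      ((Prod.snd : ℝ × ℝ → ℝ) ⁻¹' Ioo (b₀ - β) (b₀ + β)) :=
    (hM.comp continuousOn_snd fun x hx => hx).sub continuousOn_fst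
  have h3 := h2.isOpen_inter_preimage h1 (isOpen_Ioi (a := (0 : ℝ)))
  have h4 : IsOpen {x : ℝ × ℝ | μ₀ - δ < x.1} := isOpen_lt continuous_const continuous_fst
  have : subgraph μ₀ δ b₀ β M = ((Prod.snd : ℝ × ℝ → ℝ) ⁻¹' Ioo (b₀ - β) (b₀ + β) ∩
      (fun x : ℝ × ℝ => M x.2 - x.1) ⁻¹' Ioi 0) ∩ {x : ℝ × ℝ | μ₀ - δ < x.1} := by
    ext x
    simp only [subgraph, mem_ofPred_eq, mem_inter_iff, mem_preimage, mem_Ioi, sub_pos]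
    tauto
  rw [this]
  exact h3.inter h4

theorem isConnected_subgraph (hβ : 0 < β) (hM : ContinuousOn M (Ioo (b₀ - β) (b₀ + β)))
    (hMδ : ∀ b ∈ Ioo (b₀ - β) (b₀ + β), μ₀ - δ < M b) : IsConnected (subgraph μ₀ δ b₀ β M) := by
  have himg : subgraph μ₀ δ b₀ β M = (fun x : ℝ × ℝ => (μ₀ - δ + x.2 * (M x.1 - (μ₀ - δ)), x.1)) ''
      (Ioo (b₀ - β) (b₀ + β) ×ˢ Ioo (0 : ℝ) 1) := by
    ext ⟨μ, b⟩
    constructor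
    · rintro ⟨hb, h1, h2⟩
      have hpos := sub_pos.2 (hMδ b hb)
      simp only at hb h1 h2
      refine ⟨(b, (μ - (μ₀ - δ)) / (M b - (μ₀ - δ))), ⟨hb, div_pos (by linarith) hpos,
        (div_lt_one hpos).2 (by linarith)⟩, ?_⟩
      simp only
      rw [div_mul_cancel₀ _ hpos.ne']
      simp
    · rintro ⟨⟨b', θ⟩, ⟨hb, h1, h2⟩, he⟩
      simp only [Prod.mk.injEq] at he hb h1 h2
      obtain ⟨rfl, rfl⟩ := he
      have hpos := sub_pos.2 (hMδ b' hb)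
      refine ⟨hb, ?_, ?_⟩ <;> simp only <;> nlinarith
  rw [himg]
  refine IsConnected.image (IsConnected.prod (isConnected_Ioo (by linarith))
    (isConnected_Ioo one_pos)) _ ?_
  have : ContinuousOn (fun x : ℝ × ℝ => M x.1) (Ioo (b₀ - β) (b₀ + β) ×ˢ Ioo (0 : ℝ) 1) :=
    hM.comp continuousOn_fst fun x hx => hx.1
  exact (continuousOn_const.add (continuousOn_snd.mul (this.sub continuousOn_const))).prodMk
    continuousOn_fst

end

/-- A function `R (μ, γ, b)` that vanishes at `(μ₀, 0, b₀)`, is continuous nearby, strictly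
decreasing in `μ` at `γ = 0`, and strictly decreasing in `γ ≥ 0`, has as zero set near that point
the graph of a positive function `Γ` over the region below a curve `μ = M b`, together with that
curve at `γ = 0`, where `Γ` tends to `0`. -/
theorem exists_zero_surface {R : ℝ × ℝ × ℝ → ℝ} {μ₀ b₀ d : ℝ} {G : ℝ × ℝ × ℝ → Prop} (hd : 0 < d)
    (hR0 : R (μ₀, 0, b₀) = 0) (hc : ∀ᶠ p in 𝓝 (μ₀, 0, b₀), ContinuousAt R p)
    (hG : ∀ᶠ p in 𝓝 (μ₀, 0, b₀), G p)
    (hμ : ∀ᶠ z : (ℝ × ℝ × ℝ) × (ℝ × ℝ × ℝ) in 𝓝 ((μ₀, 0, b₀), (μ₀, 0, b₀)),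
      z.1.2.1 = 0 → z.2.2.1 = 0 → z.1.2.2 = z.2.2.2 → z.1.1 < z.2.1 → R z.2 < R z.1)
    (hγ : ∀ᶠ z : (ℝ × ℝ × ℝ) × (ℝ × ℝ × ℝ) in 𝓝 ((μ₀, 0, b₀), (μ₀, 0, b₀)),
      z.1.1 = z.2.1 → z.1.2.2 = z.2.2.2 → 0 ≤ z.2.2.1 → z.2.2.1 < z.1.2.1 → R z.1 < R z.2) :
    ∃ (δ β : ℝ) (M : ℝ → ℝ) (Γ : ℝ × ℝ → ℝ), 0 < δ ∧ δ ≤ d ∧ 0 < β ∧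
      ContinuousOn M (Ioo (b₀ - β) (b₀ + β)) ∧
      (∀ b ∈ Ioo (b₀ - β) (b₀ + β), μ₀ - δ < M b ∧ R (M b, 0, b) = 0 ∧ G (M b, 0, b)) ∧
      ContinuousOn Γ (subgraph μ₀ δ b₀ β M) ∧
      (∀ x ∈ subgraph μ₀ δ b₀ β M, 0 < Γ x ∧ R (x.1, Γ x, x.2) = 0 ∧ G (x.1, Γ x, x.2)) ∧
      ∀ b ∈ Ioo (b₀ - β) (b₀ + β),
        Tendsto Γ (𝓝[subgraph μ₀ δ b₀ β M] (M b, b)) (𝓝 0) := by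
  -- a box on which all the hypotheses hold
  obtain ⟨r, hr, hbox⟩ : ∃ r > 0, ∀ μ γ b : ℝ, |μ - μ₀| < r → |γ| < r → |b - b₀| < r →
      (ContinuousAt R (μ, γ, b) ∧ G (μ, γ, b)) ∧
      (∀ μ', |μ' - μ₀| < r → μ < μ' → R (μ', 0, b) < R (μ, 0, b)) ∧
      (∀ γ', |γ'| < r → 0 ≤ γ → γ < γ' → R (μ, γ', b) < R (μ, γ, b)) := by
    obtain ⟨r₁, hr₁, h₁⟩ := Metric.eventually_nhds_iff.1 (hc.and hG)
    obtain ⟨r₂, hr₂, h₂⟩ := Metric.eventually_nhds_iff.1 (hμ.and hγ)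
    refine ⟨min r₁ r₂, lt_min hr₁ hr₂, fun μ γ b h1 h2 h3 => ?_⟩
    have hdist : ∀ {ρ μ γ b : ℝ}, |μ - μ₀| < ρ → |γ| < ρ → |b - b₀| < ρ →
        dist ((μ, γ, b) : ℝ × ℝ × ℝ) (μ₀, 0, b₀) < ρ := fun h1 h2 h3 => by
      rw [Prod.dist_eq, Prod.dist_eq]
      simp only [Real.dist_eq, sub_zero]
      exact max_lt h1 (max_lt h2 h3)
    rw [lt_min_iff] at h1 h2 h3
    refine ⟨h₁ (hdist h1.1 h2.1 h3.1), fun μ' hμ' hlt => ?_, fun γ' hγ' hγ0 hlt => ?_⟩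
    · rw [lt_min_iff] at hμ'
      refine (h₂ (y := ((μ, 0, b), (μ', 0, b))) ?_).1 rfl rfl rfl hlt
      rw [Prod.dist_eq]
      exact max_lt (hdist h1.2 (by simpa using hr₂) h3.2) (hdist hμ'.2 (by simpa using hr₂) h3.2)
    · rw [lt_min_iff] at hγ'
      refine (h₂ (y := ((μ, γ', b), (μ, γ, b))) ?_).2 rfl rfl hγ0 hlt
      rw [Prod.dist_eq]
      exact max_lt (hdist h1.2 hγ'.2 h3.2) (hdist h1.2 h2.2 h3.2)
  have h00 : |(0 : ℝ)| < r := by simpa using hr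
  have hμμ : |μ₀ - μ₀| < r := by simpa using hr
  have hbb : |b₀ - b₀| < r := by simpa using hr
  set γ₁ := r / 2 with hγ₁_def
  have hγ₁ : 0 < γ₁ := by positivity
  have hγ₁r : |γ₁| < r := by
    rw [abs_of_pos hγ₁]
    linarith
  -- first `γ₁`, then the range of `μ`, then the range of `b`
  have hneg : R (μ₀, γ₁, b₀) < 0 := by
    have := (hbox μ₀ 0 b₀ hμμ h00 hbb).2.2 γ₁ hγ₁r le_rfl hγ₁
    rwa [hR0] at this
  obtain ⟨s, hs, hsneg⟩ : ∃ s > 0, ∀ μ b : ℝ, |μ - μ₀| < s → |b - b₀| < s → R (μ, γ₁, b) < 0 := by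
    have hcont := (hbox μ₀ γ₁ b₀ hμμ hγ₁r hbb).1.1
    obtain ⟨s, hs, h⟩ := Metric.eventually_nhds_iff.1 (hcont.eventually (gt_mem_nhds hneg))
    refine ⟨s, hs, fun μ b h1 h2 => h ?_⟩
    rw [Prod.dist_eq, Prod.dist_eq]
    simp only [Real.dist_eq, sub_self, abs_zero]
    exact max_lt h1 (max_lt hs h2)
  set δ := min d (min s r / 2) with hδ_def
  have hδ : 0 < δ := by positivity
  have hδ2 : δ ≤ min s r / 2 := min_le_right _ _
  have hδs : δ < s := by linarith [min_le_left s r, lt_min hs hr]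
  have hδr : δ < r := by linarith [min_le_right s r, lt_min hs hr]
  have hm : |μ₀ - δ - μ₀| < r := by rwa [sub_sub_cancel_left, abs_neg, abs_of_pos hδ]
  have hp : |μ₀ + δ - μ₀| < r := by rwa [add_sub_cancel_left, abs_of_pos hδ]
  have hRm : 0 < R (μ₀ - δ, 0, b₀) := by
    have := (hbox (μ₀ - δ) 0 b₀ hm h00 hbb).2.1 μ₀ hμμ (by linarith)
    rwa [hR0] at this
  have hRp : R (μ₀ + δ, 0, b₀) < 0 := by
    have := (hbox μ₀ 0 b₀ hμμ h00 hbb).2.1 (μ₀ + δ) hp (by linarith)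
    rwa [hR0] at this
  obtain ⟨β, hβ, hβs, hβr, hβm⟩ : ∃ β > 0, β ≤ s ∧ β ≤ r ∧ ∀ b, |b - b₀| < β →
      0 < R (μ₀ - δ, 0, b) ∧ R (μ₀ + δ, 0, b) < 0 := by
    have c1 : ContinuousAt (fun b => R (μ₀ - δ, 0, b)) b₀ :=
      ContinuousAt.comp (f := fun b : ℝ => (μ₀ - δ, (0 : ℝ), b)) (hbox _ _ _ hm h00 hbb).1.1
        (by fun_prop)
    have c2 : ContinuousAt (fun b => R (μ₀ + δ, 0, b)) b₀ :=
      ContinuousAt.comp (f := fun b : ℝ => (μ₀ + δ, (0 : ℝ), b)) (hbox _ _ _ hp h00 hbb).1.1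
        (by fun_prop)
    obtain ⟨β, hβ, h⟩ := Metric.eventually_nhds_iff.1
      ((c1.eventually (lt_mem_nhds hRm)).and (c2.eventually (gt_mem_nhds hRp)))
    exact ⟨min β (min s r), by positivity, (min_le_right _ _).trans (min_le_left _ _),
      (min_le_right _ _).trans (min_le_right _ _), fun b hb => h (lt_of_lt_of_le hb (min_le_left _ _))⟩
  have hJ : ∀ {b}, b ∈ Ioo (b₀ - β) (b₀ + β) → |b - b₀| < β := fun hb => by
    rw [abs_lt]
    constructor <;> linarith [hb.1, hb.2]
  have hI : ∀ {μ}, μ ∈ Icc (μ₀ - δ) (μ₀ + δ) → |μ - μ₀| ≤ δ := fun hμ => by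
    rw [abs_le]
    constructor <;> linarith [hμ.1, hμ.2]
  have hγI : ∀ {γ}, γ ∈ Icc 0 γ₁ → |γ| < r := fun hγ => by
    rw [abs_of_nonneg hγ.1]
    linarith [hγ.2]
  have antiμ : ∀ b ∈ Ioo (b₀ - β) (b₀ + β),
      StrictAntiOn (fun μ => R (μ, 0, b)) (Icc (μ₀ - δ) (μ₀ + δ)) := fun b hb μ hμ μ' hμ' hlt =>
    (hbox μ 0 b ((hI hμ).trans_lt hδr) h00 ((hJ hb).trans_le hβr)).2.1 μ'
      ((hI hμ').trans_lt hδr) hlt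
  have exM : ∀ b, ∃ μ, b ∈ Ioo (b₀ - β) (b₀ + β) → μ ∈ Ioo (μ₀ - δ) (μ₀ + δ) ∧ R (μ, 0, b) = 0 := by
    intro b
    by_cases hb : b ∈ Ioo (b₀ - β) (b₀ + β)
    · have hcont : ContinuousOn (fun μ => R (μ, 0, b)) (Icc (μ₀ - δ) (μ₀ + δ)) := fun μ hμ =>
        (ContinuousAt.comp (f := fun μ : ℝ => (μ, (0 : ℝ), b))
          (hbox μ 0 b ((hI hμ).trans_lt hδr) h00 ((hJ hb).trans_le hβr)).1.1
          (by fun_prop)).continuousWithinAt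
      obtain ⟨h1, h2⟩ := hβm b (hJ hb)
      obtain ⟨μ, hμ, h0⟩ := intermediate_value_Ioo' (by linarith) hcont ⟨h2, h1⟩
      exact ⟨μ, fun _ => ⟨hμ, h0⟩⟩
    · exact ⟨0, fun h => absurd h hb⟩
  choose M hM using exM
  have antiγ : ∀ x ∈ subgraph μ₀ δ b₀ β M ∪ {x | x.2 ∈ Ioo (b₀ - β) (b₀ + β) ∧ x.1 = M x.2},
      StrictAntiOn (fun γ => R (x.1, γ, x.2)) (Icc 0 γ₁) ∧
      ∀ γ ∈ Icc 0 γ₁, ContinuousAt R (x.1, γ, x.2) ∧ G (x.1, γ, x.2) := by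
    intro x hx
    have hx' : x.2 ∈ Ioo (b₀ - β) (b₀ + β) ∧ x.1 ∈ Icc (μ₀ - δ) (μ₀ + δ) := by
      rcases hx with ⟨h1, h2, h3⟩ | ⟨h1, h2⟩
      · exact ⟨h1, h2.le, (h3.trans (hM _ h1).1.2).le⟩
      · rw [h2]
        exact ⟨h1, Ioo_subset_Icc_self (hM _ h1).1⟩
    have hbx := fun γ (hγ : γ ∈ Icc 0 γ₁) => hbox x.1 γ x.2 ((hI hx'.2).trans_lt hδr) (hγI hγ)
      ((hJ hx'.1).trans_le hβr)
    exact ⟨fun γ hγ γ' hγ' hlt => (hbx γ hγ).2.2 γ' (hγI hγ') hγ.1 hlt,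
      fun γ hγ => (hbx γ hγ).1⟩
  have exΓ : ∀ x, ∃ γ, x ∈ subgraph μ₀ δ b₀ β M → γ ∈ Ioo 0 γ₁ ∧ R (x.1, γ, x.2) = 0 := by
    intro x
    by_cases hx : x ∈ subgraph μ₀ δ b₀ β M
    · have hcont : ContinuousOn (fun γ => R (x.1, γ, x.2)) (Icc 0 γ₁) := fun γ hγ =>
        (ContinuousAt.comp (f := fun γ : ℝ => (x.1, γ, x.2)) ((antiγ x (Or.inl hx)).2 γ hγ).1
          (by fun_prop)).continuousWithinAt
      obtain ⟨hb, h1, h2⟩ := hx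
      obtain ⟨hMI, hM0⟩ := hM x.2 hb
      have hxI : x.1 ∈ Icc (μ₀ - δ) (μ₀ + δ) := ⟨h1.le, (h2.trans hMI.2).le⟩
      have hpos : R (M x.2, 0, x.2) < R (x.1, 0, x.2) :=
        antiμ x.2 hb hxI (Ioo_subset_Icc_self hMI) h2
      rw [hM0] at hpos
      have hneg := hsneg x.1 x.2 ((hI hxI).trans_lt hδs) ((hJ hb).trans_le hβs)
      obtain ⟨γ, hγ, h0⟩ := intermediate_value_Ioo' hγ₁.le hcont ⟨hneg, hpos⟩
      exact ⟨γ, fun _ => ⟨hγ, h0⟩⟩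
    · exact ⟨0, fun h => absurd h hx⟩
  choose Γ hΓ using exΓ
  refine ⟨δ, β, M, Γ, hδ, min_le_left _ _, hβ, ?_, fun b hb => ?_, ?_, fun x hx => ?_,
    fun b hb => ?_⟩
  · refine continuousOn_of_strictAntiOn_zero (F := fun b μ => R (μ, 0, b)) antiμ
      (fun b hb μ hμ => ?_) hM
    exact ContinuousAt.comp (f := fun b : ℝ => (μ, (0 : ℝ), b))
      (hbox μ 0 b ((hI hμ).trans_lt hδr) h00 ((hJ hb).trans_le hβr)).1.1 (by fun_prop)
  · obtain ⟨h1, h2⟩ := hM b hb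
    exact ⟨h1.1, h2, ((antiγ (M b, b) (Or.inr ⟨hb, rfl⟩)).2 0 ⟨le_rfl, hγ₁.le⟩).2⟩
  · refine continuousOn_of_strictAntiOn_zero (F := fun x γ => R (x.1, γ, x.2))
      (fun x hx => (antiγ x (Or.inl hx)).1) (fun x hx γ hγ => ?_) hΓ
    exact ContinuousAt.comp (f := fun x : ℝ × ℝ => (x.1, γ, x.2))
      ((antiγ x (Or.inl hx)).2 γ hγ).1 (by fun_prop)
  · obtain ⟨h1, h2⟩ := hΓ x hx
    exact ⟨h1.1, h2, ((antiγ x (Or.inl hx)).2 _ (Ioo_subset_Icc_self h1)).2⟩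
  · obtain ⟨h1, h2⟩ := hM b hb
    obtain ⟨k1, k2⟩ := antiγ (M b, b) (Or.inr ⟨hb, rfl⟩)
    rw [tendsto_order]
    refine ⟨fun y hy => ?_, fun y hy => ?_⟩
    · filter_upwards [self_mem_nhdsWithin] with x hx
      exact hy.trans (hΓ x hx).1.1
    · have hmem : min y γ₁ ∈ Icc 0 γ₁ := ⟨le_min hy.le hγ₁.le, min_le_right _ _⟩
      have hlt : R (M b, min y γ₁, b) < 0 := by
        rw [← h2]
        exact k1 ⟨le_rfl, hγ₁.le⟩ hmem (lt_min hy hγ₁)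
      have hcont : ContinuousAt (fun x : ℝ × ℝ => R (x.1, min y γ₁, x.2)) (M b, b) :=
        ContinuousAt.comp (f := fun x : ℝ × ℝ => (x.1, min y γ₁, x.2)) (k2 _ hmem).1 (by fun_prop)
      filter_upwards [nhdsWithin_le_nhds (hcont.eventually (gt_mem_nhds hlt)),
        self_mem_nhdsWithin] with x hx hxS
      obtain ⟨g1, g2⟩ := hΓ x hxS
      rw [← g2] at hx
      exact (((antiγ x (Or.inl hxS)).1.lt_iff_gt hmem (Ioo_subset_Icc_self g1)).1 hx).trans_le
        (min_le_left _ _)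

/-! ### Eigenfunctions of the Rayleigh equation -/

theorem hasDerivAt_ite_nonneg {g h : ℝ → ℂ} {c : ℂ} (hg : HasDerivAt g c 0) (hh : HasDerivAt h c 0)
    (h0 : g 0 = h 0) : HasDerivAt (fun t => if 0 ≤ t then g t else h t) c 0 := by
  have h1 : HasDerivWithinAt (fun t => if 0 ≤ t then g t else h t) c (Ici 0) 0 :=
    hg.hasDerivWithinAt.congr (fun t ht => if_pos ht) (if_pos le_rfl)
  have h2 : HasDerivWithinAt (fun t => if 0 ≤ t then g t else h t) c (Iic 0) 0 := by
    refine hh.hasDerivWithinAt.congr (fun t ht => ?_) (by simp [h0])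
    rcases (show t ≤ 0 from ht).eq_or_lt with rfl | hlt
    · simp [h0]
    · exact if_neg hlt.not_ge
  have := h1.union h2
  rwa [union_comm, Iic_union_Ici, hasDerivWithinAt_univ] at this

/-- A solution on `[0, T]` of an equation with conjugation-symmetric coefficient, with real value
and imaginary slope at `0`, extends to `[-T, T]` by `w (-t) = conj (w t)`. -/
theorem IsSol.exists_extension {q : ℝ → ℂ} {T : ℝ} {f fd : ℝ → ℂ} (h : IsSol q T f fd)
    (hq : ∀ t, q (-t) = starRingEnd ℂ (q t)) (hT : 0 < T) (h0 : f 0 = 1) (h0' : (fd 0).re = 0) :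
    ∃ w wd : ℝ → ℂ, w 0 = 1 ∧ w T = f T ∧ w (-T) = starRingEnd ℂ (f T) ∧
      ∀ t ∈ Icc (-T) T, HasDerivAt w (wd t) t ∧ HasDerivAt wd (q t * w t) t := by
  have hfd0 : -starRingEnd ℂ (fd 0) = fd 0 := by
    apply Complex.ext <;> simp [h0']
  have r1 : ∀ t ∈ Icc (-T) 0, HasDerivAt (fun t => starRingEnd ℂ (f (-t)))
      (-starRingEnd ℂ (fd (-t))) t := fun t ht => by
    have h1 := h.deriv_fst (-t) ⟨by linarith [ht.2], by linarith [ht.1]⟩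
    refine ((h1.star).scomp t (hasDerivAt_neg t)).congr_deriv ?_
    rw [neg_one_smul]
    rfl
  have r2 : ∀ t ∈ Icc (-T) 0, HasDerivAt (fun t => -starRingEnd ℂ (fd (-t)))
      (q t * starRingEnd ℂ (f (-t))) t := fun t ht => by
    have h1 := h.deriv_snd (-t) ⟨by linarith [ht.2], by linarith [ht.1]⟩
    refine ((h1.star).scomp t (hasDerivAt_neg t)).neg.congr_deriv ?_
    rw [hq]
    simp [mul_comm]
  refine ⟨fun t => if 0 ≤ t then f t else starRingEnd ℂ (f (-t)),
    fun t => if 0 ≤ t then fd t else -starRingEnd ℂ (fd (-t)), by simp [h0], if_pos hT.le, ?_, ?_⟩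
  · simp only [Left.nonneg_neg_iff, neg_neg]
    exact if_neg hT.not_ge
  · intro t ht
    rcases lt_trichotomy t 0 with hlt | rfl | hgt
    · have ht' : t ∈ Icc (-T) 0 := ⟨ht.1, hlt.le⟩
      have hev : ∀ᶠ s in 𝓝 t, ¬(0 ≤ s) := (gt_mem_nhds hlt).mono fun s hs => hs.not_ge
      simp only [if_neg hlt.not_ge]
      exact ⟨(r1 t ht').congr_of_eventuallyEq (hev.mono fun s hs => if_neg hs),
        (r2 t ht').congr_of_eventuallyEq (hev.mono fun s hs => if_neg hs)⟩
    · have hm : (0 : ℝ) ∈ Icc 0 T := ⟨le_rfl, hT.le⟩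
      have hm' : (0 : ℝ) ∈ Icc (-T) 0 := ⟨by linarith, le_rfl⟩
      have e1 := r1 0 hm'
      have e2 := r2 0 hm'
      rw [neg_zero, hfd0] at e1
      rw [neg_zero, h0, map_one, ← h0] at e2
      simp only [le_refl, if_true]
      refine ⟨hasDerivAt_ite_nonneg (h.deriv_fst 0 hm) e1 (by simp [h0]),
        hasDerivAt_ite_nonneg (h.deriv_snd 0 hm) e2 (by simp [hfd0])⟩
    · have ht' : t ∈ Icc 0 T := ⟨hgt.le, ht.2⟩
      have hev : ∀ᶠ s in 𝓝 t, 0 ≤ s := (lt_mem_nhds hgt).mono fun s hs => le_of_lt hs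
      simp only [if_pos hgt.le]
      exact ⟨(h.deriv_fst t ht').congr_of_eventuallyEq (hev.mono fun s hs => if_pos hs),
        (h.deriv_snd t ht').congr_of_eventuallyEq (hev.mono fun s hs => if_pos hs)⟩

/-- Elliptic regularity in one variable. -/
theorem contDiffOn_infty_of_deriv_deriv_eq {s : Set ℝ} (hs : IsOpen s) {v q : ℝ → ℂ}
    (hv : ContDiffOn ℝ 2 v s) (hq : ContDiff ℝ ∞ q)
    (heq : ∀ y ∈ s, deriv (deriv v) y = q y * v y) : ContDiffOn ℝ ∞ v s := by
  rw [contDiffOn_infty]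
  have h2 := (contDiffOn_succ_iff_deriv_of_isOpen (n := 1) hs).1 hv
  have h1 := (contDiffOn_succ_iff_deriv_of_isOpen (n := 0) hs).1 h2.2.2
  intro n
  induction n with
  | zero => exact hv.of_le (by simp)
  | succ n ih =>
    have e1 : ContDiffOn ℝ n (deriv (deriv v)) s :=
      ((hq.contDiffOn.of_le (by exact_mod_cast le_top)).mul ih).congr heq
    have e2 : ContDiffOn ℝ (n + 1) (deriv v) s :=
      (contDiffOn_succ_iff_deriv_of_isOpen hs).2 ⟨h1.1, by simp, e1⟩
    have e3 : ContDiffOn ℝ (n + 1) v s :=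
      (contDiffOn_succ_iff_deriv_of_isOpen hs).2 ⟨h2.1, by simp, e2.of_le (by simp)⟩
    exact_mod_cast e3

theorem contDiffOn_two_of_hasDerivAt {s : Set ℝ} (hs : IsOpen s) {v vd vdd : ℝ → ℂ}
    (h1 : ∀ y ∈ s, HasDerivAt v (vd y) y) (h2 : ∀ y ∈ s, HasDerivAt vd (vdd y) y)
    (hc : ContinuousOn vdd s) :
    ContDiffOn ℝ 2 v s ∧ ∀ y ∈ s, deriv (deriv v) y = vdd y := by
  have e : ∀ y ∈ s, deriv v =ᶠ[𝓝 y] vd := fun y hy => by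
    filter_upwards [hs.mem_nhds hy] with z hz using (h1 z hz).deriv
  have e2 : ∀ y ∈ s, HasDerivAt (deriv v) (vdd y) y := fun y hy =>
    (h2 y hy).congr_of_eventuallyEq (e y hy)
  have c1 : ContDiffOn ℝ (0 + 1) (deriv v) s :=
    (contDiffOn_succ_iff_deriv_of_isOpen hs).2
      ⟨fun y hy => (e2 y hy).differentiableAt.differentiableWithinAt, by simp,
        contDiffOn_zero.2 (hc.congr fun y hy => (e2 y hy).deriv)⟩
  refine ⟨?_, fun y hy => (e2 y hy).deriv⟩
  have c2 : ContDiffOn ℝ (1 + 1) v s := (contDiffOn_succ_iff_deriv_of_isOpen hs).2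
      ⟨fun y hy => (h1 y hy).differentiableAt.differentiableWithinAt, by simp, by simpa using c1⟩
  exact c2.of_le (by norm_num)

theorem contDiff_profileU : ContDiff ℝ ∞ profileU := contDiff_id

theorem contDiff_profileW (A : ℝ) (n : ℕ) : ContDiff ℝ ∞ (profileW A n) :=
  contDiff_const.mul (Real.contDiff_sin.comp (contDiff_const.mul contDiff_id))

theorem deriv_profileU : deriv profileU = fun _ => 1 := by
  ext y
  exact deriv_id y

theorem deriv_deriv_profileU (y : ℝ) : deriv (deriv profileU) y = 0 := by
  simp [deriv_profileU]

theorem deriv_deriv_profileW (A : ℝ) (n : ℕ) (y : ℝ) : deriv (deriv (profileW A n)) y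
    = -(A / n * (4 * n * Real.pi) ^ 2 * Real.sin (4 * n * Real.pi * y)) := by
  have h1 : deriv (profileW A n)
      = fun y => A / n * (4 * n * Real.pi) * Real.cos (4 * n * Real.pi * y) := by
    ext y
    have := (((hasDerivAt_id y).const_mul (4 * n * Real.pi)).sin).const_mul (A / n)
    refine (this.congr_deriv ?_).deriv
    simp only [id]
    ring
  rw [h1]
  have := (((hasDerivAt_id y).const_mul (4 * n * Real.pi)).cos).const_mul (A / n * (4 * n * Real.pi))
  refine (this.congr_deriv ?_).deriv
  simp only [id]
  ring

/-- The scaled wave number `4 n π`. -/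
noncomputable def waveScale (n : ℕ) : ℝ := 4 * n * Real.pi

theorem waveScale_pos {n : ℕ} (hn : 1 ≤ n) : 0 < waveScale n := by
  have : (0 : ℝ) < n := by exact_mod_cast hn
  rw [waveScale]
  positivity

/-- The wave numbers `(k₁, k₃)` and the eigenvalue `σ` correspond to the parameters `(μ, γ, b)` of
the rescaled equation, obtained with `t = m (y - 1 / 2)` for the wave scale `m`: the ratio `k₃ / k₁`
is `b / (4 π A)`, and `σ / k₁ = 1 / 2 + i γ / m`. -/
structure Corresponds (A : ℝ) (n : ℕ) (k₁ k₃ : ℝ) (σ : ℂ) (μ γ b : ℝ) : Prop where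
  pos : 0 < k₁
  slope : 4 * Real.pi * A * k₃ = b * k₁
  energy : k₁ ^ 2 + k₃ ^ 2 = waveScale n ^ 2 * μ
  eigenvalue : σ = k₁ / 2 + k₁ * γ / waveScale n * Complex.I

namespace Corresponds

variable {A : ℝ} {n : ℕ} {k₁ k₃ : ℝ} {σ : ℂ} {μ γ b : ℝ}

theorem denominator_eq (h : Corresponds A n k₁ k₃ σ μ γ b) (hn : 1 ≤ n) (y : ℝ) :
    (k₁ * profileU y + k₃ * profileW A n y - σ : ℂ) = k₁ / waveScale n *
      ((waveScale n * (y - 1 / 2) : ℝ) + b * Real.sin (waveScale n * (y - 1 / 2))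
        - γ * Complex.I) ∧
    (k₁ * deriv (deriv profileU) y + k₃ * deriv (deriv (profileW A n)) y : ℂ)
      = -(k₁ * waveScale n * (b * Real.sin (waveScale n * (y - 1 / 2)))) := by
  have hsin : Real.sin (waveScale n * (y - 1 / 2)) = Real.sin (4 * n * Real.pi * y) := by
    have : waveScale n * (y - 1 / 2) = 4 * n * Real.pi * y - n * (2 * Real.pi) := by
      rw [waveScale]
      ring
    rw [this, Real.sin_sub_nat_mul_two_pi]
  have hm := waveScale_pos hn
  have hmc : (waveScale n : ℂ) ≠ 0 := by exact_mod_cast hm.ne'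
  have hn0 : (n : ℂ) ≠ 0 := by exact_mod_cast (by omega : n ≠ 0)
  have hslope : (4 * Real.pi * A * k₃ : ℂ) = b * k₁ := by exact_mod_cast h.slope
  have hmdef : (waveScale n : ℂ) = 4 * n * Real.pi := by
    rw [waveScale]
    push_cast
    rfl
  have hk : (k₃ * (A / n) : ℂ) = k₁ * b / waveScale n := by
    rw [mul_div_assoc', div_eq_div_iff hn0 hmc, hmdef]
    linear_combination (n : ℂ) * hslope
  constructor
  · rw [h.eigenvalue, hsin, profileU, profileW]
    generalize Real.sin (4 * n * Real.pi * y) = S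
    push_cast
    rw [← mul_assoc, hk]
    field_simp
    ring
  · rw [deriv_deriv_profileU, deriv_deriv_profileW, hsin, ← waveScale]
    generalize Real.sin (waveScale n * y) = S
    push_cast
    rw [mul_zero, zero_add]
    have : (k₃ * -(A / n * waveScale n ^ 2 * S) : ℂ) = -(k₃ * (A / n) * waveScale n ^ 2 * S) := by
      ring
    rw [this, hk]
    field_simp

theorem rayleigh_coeff (h : Corresponds A n k₁ k₃ σ μ γ b) (hn : 1 ≤ n) {y : ℝ}
    (hy : y ≠ 1 / 2 ∨ γ ≠ 0) :
    (k₁ ^ 2 + k₃ ^ 2 : ℂ) + (k₁ * deriv (deriv profileU) y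
        + k₃ * deriv (deriv (profileW A n)) y : ℂ) / (k₁ * profileU y + k₃ * profileW A n y - σ)
      = waveScale n ^ 2 * coeff μ γ b (waveScale n * (y - 1 / 2)) := by
  obtain ⟨h1, h2⟩ := h.denominator_eq hn y
  have hm := waveScale_pos hn
  have hmc : (waveScale n : ℂ) ≠ 0 := by exact_mod_cast hm.ne'
  have hk₁ : (k₁ : ℂ) ≠ 0 := by exact_mod_cast h.pos.ne'
  have hE : (k₁ ^ 2 + k₃ ^ 2 : ℂ) = waveScale n ^ 2 * μ := by exact_mod_cast h.energy
  have ht : waveScale n * (y - 1 / 2) ≠ 0 ∨ γ ≠ 0 :=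
    hy.imp_left fun hy => mul_ne_zero hm.ne' (sub_ne_zero.2 hy)
  rw [h1, h2, hE, coeff_eq μ ht]
  generalize ((waveScale n * (y - 1 / 2) : ℝ) + b * Real.sin (waveScale n * (y - 1 / 2))
        - γ * Complex.I : ℂ) = D
  field_simp
  ring

theorem denominator_ne_zero (h : Corresponds A n k₁ k₃ σ μ γ b) (hn : 1 ≤ n) (hb : b ∈ Ioo 0 3.1)
    {y : ℝ} (hy : y ≠ 1 / 2 ∨ γ ≠ 0) : (k₁ * profileU y + k₃ * profileW A n y - σ : ℂ) ≠ 0 := by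
  have hm := waveScale_pos hn
  have hmc : (waveScale n : ℂ) ≠ 0 := by exact_mod_cast hm.ne'
  have hk₁ : (k₁ : ℂ) ≠ 0 := by exact_mod_cast h.pos.ne'
  rw [(h.denominator_eq hn y).1]
  exact mul_ne_zero (div_ne_zero hk₁ hmc) (shear_sub_ne_zero hb
    (hy.imp_left fun hy => mul_ne_zero hm.ne' (sub_ne_zero.2 hy)))

theorem contDiff_coeff (n : ℕ) (μ γ : ℝ) (hb : b ∈ Ioo 0 3.1) :
    ContDiff ℝ ∞ fun y : ℝ => (waveScale n ^ 2 * coeff μ γ b (waveScale n * (y - 1 / 2)) : ℂ) :=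
  contDiff_const.mul ((_root_.contDiff_coeff μ γ hb).comp
    (contDiff_const.mul (contDiff_id.sub contDiff_const)))

/-- All eigenfunctions are smooth: they solve an equation with smooth coefficient, at the critical
layer of a neutral mode by continuity. -/
theorem contDiffOn (h : Corresponds A n k₁ k₃ σ μ γ b) (hn : 1 ≤ n) (hb : b ∈ Ioo 0 3.1)
    {v : ℝ → ℂ} (hv : IsRayleighMode 0 1 profileU (profileW A n) k₁ k₃ σ v) :
    ContDiffOn ℝ ∞ v (Ioo 0 1) := by
  have hq := contDiff_coeff n μ γ hb
  refine contDiffOn_infty_of_deriv_deriv_eq isOpen_Ioo hv.contDiffOn hq fun y hy => ?_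
  have hne : ∀ y ∈ Ioo (0 : ℝ) 1, y ≠ 1 / 2 → deriv (deriv v) y
      = waveScale n ^ 2 * coeff μ γ b (waveScale n * (y - 1 / 2)) * v y := fun y hy hne => by
    have := hv.rayleigh y hy (h.denominator_ne_zero hn hb (Or.inl hne))
    rw [← h.rayleigh_coeff hn (Or.inl hne)]
    linear_combination this
  rcases ne_or_eq y (1 / 2) with hy2 | rfl
  · exact hne y hy hy2
  have h2 := (contDiffOn_succ_iff_deriv_of_isOpen (n := 1) isOpen_Ioo).1 hv.contDiffOn
  have h1 := (contDiffOn_succ_iff_deriv_of_isOpen (n := 0) isOpen_Ioo).1 h2.2.2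
  have c1 : ContinuousAt (deriv (deriv v)) (1 / 2) :=
    h1.2.2.continuousOn.continuousAt (isOpen_Ioo.mem_nhds hy)
  have c2 : ContinuousAt (fun y : ℝ => waveScale n ^ 2 * coeff μ γ b (waveScale n * (y - 1 / 2))
      * v y : ℝ → ℂ) (1 / 2) :=
    hq.continuous.continuousAt.mul (hv.contDiffOn.continuousOn.continuousAt (isOpen_Ioo.mem_nhds hy))
  have hev : deriv (deriv v) =ᶠ[𝓝[≠] (1 / 2 : ℝ)] fun y : ℝ =>
      (waveScale n ^ 2 * coeff μ γ b (waveScale n * (y - 1 / 2)) * v y : ℂ) := by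
    filter_upwards [self_mem_nhdsWithin, nhdsWithin_le_nhds (isOpen_Ioo.mem_nhds hy)] with z hz hz'
    exact hne z hz' hz
  exact tendsto_nhds_unique (c1.tendsto.mono_left nhdsWithin_le_nhds)
    ((c2.tendsto.mono_left nhdsWithin_le_nhds).congr' hev.symm)

/-- When the slope of the decaying solution is imaginary, its symmetric extension is an
eigenfunction, twice differentiable up to the walls. -/
theorem exists_isRayleighMode (h : Corresponds A n k₁ k₃ σ μ γ b) (hn : 1 ≤ n)
    (hb : b ∈ Ioo 0 3.1) (hζ : (rayleighShoot (waveScale n / 2) 0 1 (μ, γ, b)).1 (waveScale n / 2) ≠ 0)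
    (hR : (slopeAt (waveScale n / 2) (μ, γ, b)).re = 0) :
    ∃ v vd : ℝ → ℂ, IsRayleighMode 0 1 profileU (profileW A n) k₁ k₃ σ v ∧
      ∀ y ∈ Icc (0 : ℝ) 1, HasDerivAt v (vd y) y ∧
        HasDerivAt vd (waveScale n ^ 2 * coeff μ γ b (waveScale n * (y - 1 / 2)) * v y) y := by
  have hm := waveScale_pos hn
  set T := waveScale n / 2 with hT_def
  have hT : 0 < T := by positivity
  obtain ⟨l1, l2, l3, l4⟩ := decay_spec (p := (μ, γ, b)) hT.le hb hζ
  obtain ⟨w, wd, w1, w2, w3, w4⟩ := l4.exists_extension (fun t => coeff_neg μ γ b t) hT l1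
    (by rw [l2, hR])
  rw [l3] at w2 w3
  have hlin : ∀ y : ℝ, HasDerivAt (fun y : ℝ => waveScale n * (y - 1 / 2)) (waveScale n) y :=
    fun y => (((hasDerivAt_id y).sub_const (1 / 2)).const_mul (waveScale n)).congr_deriv (mul_one _)
  have hmem : ∀ y ∈ Icc (0 : ℝ) 1, waveScale n * (y - 1 / 2) ∈ Icc (-T) T := fun y hy => by
    rw [hT_def]
    constructor <;> nlinarith [hy.1, hy.2]
  have d1 : ∀ y ∈ Icc (0 : ℝ) 1, HasDerivAt (fun y => w (waveScale n * (y - 1 / 2)))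
      (waveScale n * wd (waveScale n * (y - 1 / 2))) y := fun y hy => by
    refine (((w4 _ (hmem y hy)).1).scomp y (hlin y)).congr_deriv ?_
    rw [Complex.real_smul]
  have d2 : ∀ y ∈ Icc (0 : ℝ) 1, HasDerivAt (fun y => waveScale n * wd (waveScale n * (y - 1 / 2)))
      (waveScale n ^ 2 * coeff μ γ b (waveScale n * (y - 1 / 2)) * w (waveScale n * (y - 1 / 2)))
      y := fun y hy => by
    have := (((w4 _ (hmem y hy)).2).scomp y (hlin y)).const_mul (waveScale n : ℂ)
    refine this.congr_deriv ?_
    simp only [Complex.real_smul]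
    ring
  refine ⟨_, _, ?_, fun y hy => ⟨d1 y hy, d2 y hy⟩⟩
  have hcont : ContinuousOn (fun y => w (waveScale n * (y - 1 / 2))) (Icc 0 1) := fun y hy =>
    (d1 y hy).continuousAt.continuousWithinAt
  obtain ⟨c2, hdd⟩ := contDiffOn_two_of_hasDerivAt isOpen_Ioo
    (fun y hy => d1 y (Ioo_subset_Icc_self hy)) (fun y hy => d2 y (Ioo_subset_Icc_self hy))
    ((contDiff_coeff n μ γ hb).continuous.continuousOn.mul (hcont.mono Ioo_subset_Icc_self))
  refine ⟨hcont, c2, ?_, ?_, ⟨1 / 2, by norm_num, by simp [w1]⟩, fun y hy hne => ?_⟩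
  · rw [← map_zero (starRingEnd ℂ), ← w3]
    congr 1
    rw [hT_def]
    ring
  · rw [← w2]
    congr 1
    rw [hT_def]
    ring
  · have hy2 : y ≠ 1 / 2 ∨ γ ≠ 0 := by
      by_contra! hcon
      apply hne
      rw [(h.denominator_eq hn y).1, hcon.1, hcon.2]
      simp
    rw [hdd y hy, ← h.rayleigh_coeff hn hy2]
    ring

end Corresponds

/-! ### From the Rayleigh equation to the linearized Euler equations -/

section

variable (k₁ k₃ : ℝ) (σ : ℂ) (t : ℝ)

/-- The phase factor of a normal mode. -/
noncomputable def phase (X : Fin 3 → ℝ) : ℂ := Complex.exp (Complex.I * (k₁ * X 0 + k₃ * X 2 - σ * t))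

variable (g : ℝ → ℂ) (X : Fin 3 → ℝ)

theorem partialD_zero_phase :
    partialD 0 (fun Y => phase k₁ k₃ σ t Y * g (Y 1)) X
      = Complex.I * k₁ * (phase k₁ k₃ σ t X * g (X 1)) := by
  refine HasLineDerivAt.lineDeriv ?_
  unfold HasLineDerivAt phase
  have h1 : HasDerivAt (fun s : ℝ => (Complex.I * (k₁ * ((X 0 + s : ℝ) : ℂ) + k₃ * X 2 - σ * t) : ℂ))
      (Complex.I * k₁) 0 := by
    have h := ((hasDerivAt_id (0 : ℝ)).const_add (X 0)).ofReal_comp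
    have := (((h.const_mul (k₁ : ℂ)).add_const (k₃ * X 2 : ℂ)).sub_const (σ * t : ℂ)).const_mul
      Complex.I
    simpa using this
  have := (h1.cexp).mul_const (g (X 1))
  simp only [Pi.add_apply, Pi.smul_apply, Pi.single_apply, smul_eq_mul]
  simp only [Fin.isValue, if_true, mul_one, show (2 : Fin 3) ≠ 0 by decide,
    show (1 : Fin 3) ≠ 0 by decide, if_false, mul_zero, add_zero]
  refine this.congr_deriv ?_
  simp only [add_zero]
  ring

theorem partialD_two_phase :
    partialD 2 (fun Y => phase k₁ k₃ σ t Y * g (Y 1)) X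
      = Complex.I * k₃ * (phase k₁ k₃ σ t X * g (X 1)) := by
  refine HasLineDerivAt.lineDeriv ?_
  unfold HasLineDerivAt phase
  have h1 : HasDerivAt (fun s : ℝ => (Complex.I * (k₁ * X 0 + k₃ * ((X 2 + s : ℝ) : ℂ) - σ * t) : ℂ))
      (Complex.I * k₃) 0 := by
    have h := ((hasDerivAt_id (0 : ℝ)).const_add (X 2)).ofReal_comp
    have := (((h.const_mul (k₃ : ℂ)).const_add (k₁ * X 0 : ℂ)).sub_const (σ * t : ℂ)).const_mul
      Complex.I
    simpa using this
  have := (h1.cexp).mul_const (g (X 1))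
  simp only [Pi.add_apply, Pi.smul_apply, Pi.single_apply, smul_eq_mul]
  simp only [Fin.isValue, if_true, mul_one, show (0 : Fin 3) ≠ 2 by decide,
    show (1 : Fin 3) ≠ 2 by decide, if_false, mul_zero, add_zero]
  refine this.congr_deriv ?_
  simp only [add_zero]
  ring

variable {g X} in
theorem partialD_one_phase {g' : ℂ} (hg : HasDerivAt g g' (X 1)) :
    partialD 1 (fun Y => phase k₁ k₃ σ t Y * g (Y 1)) X = phase k₁ k₃ σ t X * g' := by
  refine HasLineDerivAt.lineDeriv ?_
  unfold HasLineDerivAt phase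
  have h1 : HasDerivAt (fun s : ℝ => g (X 1 + s)) g' 0 := by
    have := HasDerivAt.comp_const_add (X 1) 0 (f := g) (f' := g') (by simpa using hg)
    exact this
  simp only [Pi.add_apply, Pi.smul_apply, Pi.single_apply, smul_eq_mul]
  simp only [Fin.isValue, if_true, mul_one, show (0 : Fin 3) ≠ 1 by decide,
    show (2 : Fin 3) ≠ 1 by decide, if_false, mul_zero, add_zero]
  exact h1.const_mul _

theorem deriv_phase (c : ℂ) :
    deriv (fun s : ℝ => phase k₁ k₃ σ s X * c) t = -(Complex.I * σ) * (phase k₁ k₃ σ t X * c) := by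
  unfold phase
  have h1 : HasDerivAt (fun s : ℝ => (Complex.I * (k₁ * X 0 + k₃ * X 2 - σ * (s : ℂ)) : ℂ))
      (-(Complex.I * σ)) t := by
    have h := (hasDerivAt_id t).ofReal_comp
    have := ((h.const_mul σ).const_sub (k₁ * X 0 + k₃ * X 2 : ℂ)).const_mul Complex.I
    simpa using this
  refine ((h1.cexp).mul_const c).deriv.trans ?_
  ring

end

theorem partialD_comp_one (f : ℝ → ℝ) (X : Fin 3 → ℝ) (j : Fin 3) :
    partialD j (fun Y => f (Y 1)) X = if j = 1 then deriv f (X 1) else 0 := by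
  unfold partialD lineDeriv
  simp only [Pi.add_apply, Pi.smul_apply, Pi.single_apply, smul_eq_mul]
  split_ifs with h1 h2 h2
  · simp only [mul_one]
    rw [deriv_comp_const_add, add_zero]
  · exact absurd h1.symm h2
  · exact absurd h2.symm h1
  · simp

theorem contDiff_phase (k₁ k₃ : ℝ) (σ : ℂ) :
    ContDiff ℝ ∞ fun q : ℝ × (Fin 3 → ℝ) => phase k₁ k₃ σ q.1 q.2 := by
  have h0 : ContDiff ℝ ∞ fun q : ℝ × (Fin 3 → ℝ) => ((q.2 0 : ℝ) : ℂ) :=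
    Complex.ofRealCLM.contDiff.comp ((contDiff_apply ℝ ℝ 0).comp contDiff_snd)
  have h2 : ContDiff ℝ ∞ fun q : ℝ × (Fin 3 → ℝ) => ((q.2 2 : ℝ) : ℂ) :=
    Complex.ofRealCLM.contDiff.comp ((contDiff_apply ℝ ℝ 2).comp contDiff_snd)
  have ht : ContDiff ℝ ∞ fun q : ℝ × (Fin 3 → ℝ) => ((q.1 : ℝ) : ℂ) :=
    Complex.ofRealCLM.contDiff.comp contDiff_fst
  exact (contDiff_const.mul (((contDiff_const.mul h0).add (contDiff_const.mul h2)).sub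
    (contDiff_const.mul ht))).cexp

/-- Squire's reduction read backwards: a solution `v` of the Rayleigh equation of a type II shear
is the wall-normal velocity of a normal mode of the linearized Euler equations. The pressure is
`i (Z' v - Z v') / (k₁² + k₃²)` with `Z = k₁ U + k₃ W - σ`. -/
theorem linearlyUnstable_of_rayleigh {a b : ℝ} {U W : ℝ → ℝ} (hU : ContDiff ℝ ∞ U)
    (hW : ContDiff ℝ ∞ W) {k₁ k₃ : ℝ} {σ : ℂ} (hσ : 0 < σ.im) (hα : k₁ ^ 2 + k₃ ^ 2 ≠ 0)
    {v vd : ℝ → ℂ} (hv : ∀ y ∈ Icc a b, HasDerivAt v (vd y) y)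
    (hvd : ∀ y ∈ Icc a b, HasDerivAt vd (((k₁ ^ 2 + k₃ ^ 2 : ℂ)
      + (k₁ * deriv (deriv U) y + k₃ * deriv (deriv W) y : ℂ) / (k₁ * U y + k₃ * W y - σ))
        * v y) y)
    (ha : v a = 0) (hb : v b = 0) (hne : ∃ y ∈ Ioo a b, v y ≠ 0)
    (hsm : ContDiffOn ℝ ∞ v (Ioo a b)) : LinearlyUnstable a b U W := by
  set Z : ℝ → ℂ := fun y => k₁ * U y + k₃ * W y - σ with hZ_def
  set Z' : ℝ → ℂ := fun y => k₁ * deriv U y + k₃ * deriv W y with hZ'_def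
  have hZ0 : ∀ y, Z y ≠ 0 := fun y h => by
    have := congrArg Complex.im h
    simp [hZ_def] at this
    exact hσ.ne' this
  have hαc : (k₁ ^ 2 + k₃ ^ 2 : ℂ) ≠ 0 := by exact_mod_cast hα
  have hU' : ContDiff ℝ ∞ (deriv U) := (contDiff_infty_iff_deriv.1 hU).2
  have hW' : ContDiff ℝ ∞ (deriv W) := (contDiff_infty_iff_deriv.1 hW).2
  have sU : ContDiff ℝ ∞ fun y => ((U y : ℝ) : ℂ) := Complex.ofRealCLM.contDiff.comp hU
  have sW : ContDiff ℝ ∞ fun y => ((W y : ℝ) : ℂ) := Complex.ofRealCLM.contDiff.comp hW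
  have sU' : ContDiff ℝ ∞ fun y => ((deriv U y : ℝ) : ℂ) := Complex.ofRealCLM.contDiff.comp hU'
  have sW' : ContDiff ℝ ∞ fun y => ((deriv W y : ℝ) : ℂ) := Complex.ofRealCLM.contDiff.comp hW'
  have sZ : ContDiff ℝ ∞ Z :=
    ((contDiff_const.mul sU).add (contDiff_const.mul sW)).sub contDiff_const
  have sZ' : ContDiff ℝ ∞ Z' := (contDiff_const.mul sU').add (contDiff_const.mul sW')
  have dZ : ∀ y, HasDerivAt Z (Z' y) y := fun y => by
    have h1 := ((hU.differentiable (by simp)) y).hasDerivAt.ofReal_comp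
    have h2 := ((hW.differentiable (by simp)) y).hasDerivAt.ofReal_comp
    exact ((h1.const_mul (k₁ : ℂ)).add (h2.const_mul (k₃ : ℂ))).sub_const σ
  have dZ' : ∀ y, HasDerivAt Z' (k₁ * deriv (deriv U) y + k₃ * deriv (deriv W) y) y := fun y => by
    have h1 := ((hU'.differentiable (by simp)) y).hasDerivAt.ofReal_comp
    have h2 := ((hW'.differentiable (by simp)) y).hasDerivAt.ofReal_comp
    exact (h1.const_mul (k₁ : ℂ)).add (h2.const_mul (k₃ : ℂ))
  have svd : ContDiffOn ℝ ∞ vd (Ioo a b) :=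
    ((contDiffOn_infty_iff_deriv_of_isOpen isOpen_Ioo).1 hsm).2.congr fun y hy =>
      (hv y (Ioo_subset_Icc_self hy)).deriv.symm
  have cv : ContinuousOn v (Icc a b) := fun y hy => (hv y hy).continuousAt.continuousWithinAt
  have cvd : ContinuousOn vd (Icc a b) := fun y hy => (hvd y hy).continuousAt.continuousWithinAt
  set q : ℝ → ℂ := fun y => Complex.I / (k₁ ^ 2 + k₃ ^ 2) * (Z' y * v y - Z y * vd y) with hq_def
  -- the horizontal velocity component along the profile `F`, with wave number `k`
  let comp : ℝ → (ℝ → ℝ) → ℝ → ℂ := fun k F y =>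
    (-(Complex.I * k * q y) - v y * deriv F y) * (Complex.I * Z y)⁻¹
  let φ : ℝ → Fin 3 → ℂ := fun y => ![comp k₁ U y, v y, comp k₃ W y]
  have hIZ : ∀ y, Complex.I * Z y ≠ 0 := fun y => mul_ne_zero Complex.I_ne_zero (hZ0 y)
  have sq : ContDiffOn ℝ ∞ q (Ioo a b) :=
    contDiffOn_const.mul ((sZ'.contDiffOn.mul hsm).sub (sZ.contDiffOn.mul svd))
  have cq : ContinuousOn q (Icc a b) :=
    continuousOn_const.mul ((sZ'.continuous.continuousOn.mul cv).sub
      (sZ.continuous.continuousOn.mul cvd))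
  have sinv : ContDiff ℝ ∞ fun y => (Complex.I * Z y)⁻¹ := (contDiff_const.mul sZ).inv hIZ
  have scomp : ∀ (k : ℝ) (F : ℝ → ℝ), (ContDiff ℝ ∞ fun y => ((deriv F y : ℝ) : ℂ)) →
      ContDiffOn ℝ ∞ (comp k F) (Ioo a b) := fun k F hF =>
    ((contDiffOn_const.mul sq).neg.sub (hsm.mul hF.contDiffOn)).mul sinv.contDiffOn
  have ccomp : ∀ (k : ℝ) (F : ℝ → ℝ), (ContDiff ℝ ∞ fun y => ((deriv F y : ℝ) : ℂ)) →
      ContinuousOn (comp k F) (Icc a b) := fun k F hF =>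
    ((continuousOn_const.mul cq).neg.sub (cv.mul hF.continuous.continuousOn)).mul
      sinv.continuous.continuousOn
  have sφ : ContDiffOn ℝ ∞ φ (Ioo a b) := by
    rw [contDiffOn_pi]
    intro i
    fin_cases i
    exacts [scomp k₁ U sU', hsm, scomp k₃ W sW']
  have cφ : ContinuousOn φ (Icc a b) := by
    rw [continuousOn_pi]
    intro i
    fin_cases i
    exacts [ccomp k₁ U sU', cv, ccomp k₃ W sW']
  have sX1 : ContDiff ℝ ∞ fun p : ℝ × (Fin 3 → ℝ) => p.2 1 :=
    (contDiff_apply ℝ ℝ 1).comp contDiff_snd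
  have hcomp : ∀ (k : ℝ) (F : ℝ → ℝ) (y : ℝ),
      Complex.I * Z y * comp k F y + v y * deriv F y = -(Complex.I * k * q y) := fun k F y => by
    have h := hIZ y
    simp only [comp]
    linear_combination (-(Complex.I * k * q y) - v y * ((deriv F y : ℝ) : ℂ)) * mul_inv_cancel₀ h
  have e0 : ∀ y, φ y 0 = comp k₁ U y := fun y => rfl
  have e1 : ∀ y, φ y 1 = v y := fun y => rfl
  have e2 : ∀ y, φ y 2 = comp k₃ W y := fun y => rfl
  have hq' : ∀ y ∈ Ioo a b, HasDerivAt q (-(Complex.I * Z y * v y)) y := fun y hy => by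
    have hy' := Ioo_subset_Icc_self hy
    have := (((dZ' y).mul (hv y hy')).sub ((dZ y).mul (hvd y hy'))).const_mul
      (Complex.I / (k₁ ^ 2 + k₃ ^ 2))
    refine this.congr_deriv ?_
    have hz : (k₁ * U y + k₃ * W y - σ : ℂ) = Z y := rfl
    rw [hz]
    have h := hZ0 y
    field_simp
    ring
  have hcoord : ∀ (s : ℝ) (X : Fin 3 → ℝ) (i : Fin 3),
      normalMode k₁ k₃ σ φ s X i = phase k₁ k₃ σ s X * φ (X 1) i := fun s X i => rfl
  have hpr : ∀ (s : ℝ), normalMode k₁ k₃ σ q s = fun X => phase k₁ k₃ σ s X * q (X 1) :=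
    fun s => rfl
  refine ⟨k₁, k₃, σ, φ, q, hσ, ?_, ?_, ?_, ?_, ?_, ?_, ?_, ?_⟩
  · obtain ⟨y, hy, hy0⟩ := hne
    exact ⟨y, hy, fun h => hy0 (by rw [← e1, h]; rfl)⟩
  · exact (contDiff_phase k₁ k₃ σ).contDiffOn.smul
      (sφ.comp sX1.contDiffOn fun p hp => hp.2)
  · exact (contDiff_phase k₁ k₃ σ).contDiffOn.smul
      (sq.comp sX1.contDiffOn fun p hp => hp.2)
  · exact (contDiff_phase k₁ k₃ σ).continuous.continuousOn.smul
      (cφ.comp sX1.continuous.continuousOn fun p hp => hp.2)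
  · exact (contDiff_phase k₁ k₃ σ).continuous.continuousOn.smul
      (cq.comp sX1.continuous.continuousOn fun p hp => hp.2)
  · intro t X hX i
    have hX' : X 1 ∈ Ioo a b := hX
    simp only [hcoord, hpr, Fin.sum_univ_three, deriv_phase,
      partialD_zero_phase k₁ k₃ σ t (fun y => φ y i),
      partialD_two_phase k₁ k₃ σ t (fun y => φ y i)]
    have b0 : typeIIShear U W X 0 = U (X 1) := rfl
    have b1 : typeIIShear U W X 1 = 0 := rfl
    have b2 : typeIIShear U W X 2 = W (X 1) := rfl
    have hz : (k₁ * U (X 1) + k₃ * W (X 1) - σ : ℂ) = Z (X 1) := rfl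
    rw [b0, b1, b2]
    have n01 : (0 : Fin 3) ≠ 1 := by decide
    have n21 : (2 : Fin 3) ≠ 1 := by decide
    fin_cases i
    · have hB : (fun Y => typeIIShear U W Y ((fun i => i) ⟨0, by norm_num⟩)) = fun Y => U (Y 1) := rfl
      have hp := partialD_zero_phase k₁ k₃ σ t q X
      have hc := hcomp k₁ U (X 1)
      simp only [Fin.zero_eta, Fin.isValue] at hB ⊢
      simp only [hB, partialD_comp_one, hp, e0, e1, if_neg n01, if_neg n21, if_true]
      norm_num
      rw [← hz] at hc
      linear_combination phase k₁ k₃ σ t X * hc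
    · have hB : (fun Y => typeIIShear U W Y 1) = fun _ => (fun _ : ℝ => (0 : ℝ)) 0 := rfl
      have hp := partialD_one_phase k₁ k₃ σ t (hq' _ hX')
      have hB0 : ∀ j, partialD j (fun Y => typeIIShear U W Y 1) X = 0 := fun j => by
        rw [hB]
        simp [partialD, lineDeriv]
      simp only [Fin.isValue, Fin.mk_one]
      simp only [hB0, hp, e1]
      norm_num
      rw [← hz]
      ring
    · have hB : (fun Y => typeIIShear U W Y 2) = fun Y => W (Y 1) := rfl
      have hp := partialD_two_phase k₁ k₃ σ t q X
      have hc := hcomp k₃ W (X 1)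
      simp only [Fin.reduceFinMk, Fin.isValue]
      simp only [hB, partialD_comp_one, hp, e2, e1, if_neg n01, if_neg n21, if_true]
      norm_num
      rw [← hz] at hc
      linear_combination phase k₁ k₃ σ t X * hc
  · intro t X hX
    have hX' : X 1 ∈ Ioo a b := hX
    simp only [hcoord, Fin.sum_univ_three]
    rw [partialD_zero_phase k₁ k₃ σ t (fun y => φ y 0), partialD_two_phase k₁ k₃ σ t (fun y => φ y 2),
      partialD_one_phase k₁ k₃ σ t (g := fun y => φ y 1) (hv _ (Ioo_subset_Icc_self hX'))]
    rw [e0, e2]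
    have h := hZ0 (X 1)
    have c1 := hcomp k₁ U (X 1)
    have c3 := hcomp k₃ W (X 1)
    have hqd : (k₁ ^ 2 + k₃ ^ 2 : ℂ) * q (X 1)
        = Complex.I * (Z' (X 1) * v (X 1) - Z (X 1) * vd (X 1)) := by
      rw [hq_def]
      field_simp
    have hZ'X : Z' (X 1) = k₁ * ((deriv U (X 1) : ℝ) : ℂ) + k₃ * ((deriv W (X 1) : ℝ) : ℂ) := rfl
    rw [hZ'X] at hqd
    have key : Z (X 1) * (Complex.I * k₁ * comp k₁ U (X 1) + vd (X 1)
        + Complex.I * k₃ * comp k₃ W (X 1)) = 0 := by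
      linear_combination (k₁ : ℂ) * c1 + (k₃ : ℂ) * c3 - Complex.I * hqd
        - (k₁ * ((deriv U (X 1) : ℝ) : ℂ) + k₃ * ((deriv W (X 1) : ℝ) : ℂ)) * v (X 1) * Complex.I_sq
        + Z (X 1) * vd (X 1) * Complex.I_sq
    have := (mul_eq_zero.1 key).resolve_left h
    linear_combination phase k₁ k₃ σ t X * this
  · intro t X hX
    rw [hcoord, e1]
    rcases hX with h | h <;> simp [h, ha, hb]

/-! ### The surface of unstable modes -/

/-- The scaled parameters `(μ, b)` of the wave numbers `(k₁, k₃)`, where `m` is the wave scale and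
`a = 4 π A`. -/
noncomputable def toScaled (m a : ℝ) (k : ℝ × ℝ) : ℝ × ℝ := ((k.1 ^ 2 + k.2 ^ 2) / m ^ 2, a * k.2 / k.1)

/-- The wave number `k₁ > 0` with scaled parameters `(μ, b)`. -/
noncomputable def waveNumber (m a : ℝ) (x : ℝ × ℝ) : ℝ := m * √(x.1 / (1 + (x.2 / a) ^ 2))

/-- The wave numbers `(k₁, k₃)` with scaled parameters `(μ, b)`, the inverse of `toScaled`. -/
noncomputable def ofScaled (m a : ℝ) (x : ℝ × ℝ) : ℝ × ℝ := (waveNumber m a x, x.2 / a * waveNumber m a x)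

section

variable {m a : ℝ}

theorem waveNumber_pos (hm : 0 < m) {x : ℝ × ℝ} (hx : 0 < x.1) : 0 < waveNumber m a x := by
  rw [waveNumber]
  positivity

theorem toScaled_ofScaled (hm : 0 < m) (ha : a ≠ 0) {x : ℝ × ℝ} (hx : 0 < x.1) :
    toScaled m a (ofScaled m a x) = x := by
  have hk := waveNumber_pos (a := a) hm hx
  have hsq : waveNumber m a x ^ 2 = m ^ 2 * (x.1 / (1 + (x.2 / a) ^ 2)) := by
    rw [waveNumber, mul_pow, Real.sq_sqrt (by positivity)]
  refine Prod.ext ?_ ?_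
  · have h1 : (1 + (x.2 / a) ^ 2) ≠ 0 := by positivity
    simp only [toScaled, ofScaled]
    rw [mul_pow, hsq]
    generalize x.2 / a = c at *
    field_simp
  · simp only [toScaled, ofScaled]
    field_simp

theorem ofScaled_toScaled (hm : 0 < m) (ha : a ≠ 0) {k : ℝ × ℝ} (hk : 0 < k.1) :
    ofScaled m a (toScaled m a k) = k := by
  have h : waveNumber m a (toScaled m a k) = k.1 := by
    have e : (k.1 ^ 2 + k.2 ^ 2) / m ^ 2 / (1 + (a * k.2 / k.1 / a) ^ 2) = (k.1 / m) ^ 2 := by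
      field_simp
    rw [waveNumber, toScaled, e, Real.sqrt_sq (by positivity)]
    field_simp
  refine Prod.ext h ?_
  simp only [ofScaled, h]
  simp only [toScaled]
  field_simp

theorem continuous_waveNumber : Continuous (waveNumber m a) := by
  have : ∀ x : ℝ × ℝ, 1 + (x.2 / a) ^ 2 ≠ 0 := fun x => by positivity
  unfold waveNumber
  fun_prop (disch := exact this _)

theorem continuous_ofScaled : Continuous (ofScaled m a) :=
  continuous_waveNumber.prodMk ((continuous_snd.div_const a).mul continuous_waveNumber)

theorem continuousOn_toScaled : ContinuousOn (toScaled m a) {k | 0 < k.1} := fun k hk => by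
  have h1 : ContinuousAt (fun k : ℝ × ℝ => a * k.2 / k.1) k :=
    ContinuousAt.div (by fun_prop) (by fun_prop) (ne_of_gt hk)
  exact (ContinuousAt.prodMk (by fun_prop) h1).continuousWithinAt

theorem isOpen_pos_fst : IsOpen {k : ℝ × ℝ | 0 < k.1} := isOpen_lt continuous_const continuous_fst

/-- The wave numbers whose scaled parameters lie in `S`. -/
noncomputable def waveRegion (m a : ℝ) (S : Set (ℝ × ℝ)) : Set (ℝ × ℝ) := {k | 0 < k.1 ∧ toScaled m a k ∈ S}

theorem isOpen_waveRegion {S : Set (ℝ × ℝ)} (hS : IsOpen S) : IsOpen (waveRegion m a S) :=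
  continuousOn_toScaled.isOpen_inter_preimage isOpen_pos_fst hS

theorem waveRegion_eq_image (hm : 0 < m) (ha : a ≠ 0) {S : Set (ℝ × ℝ)} (hS : ∀ x ∈ S, 0 < x.1) :
    waveRegion m a S = ofScaled m a '' S := by
  ext k
  constructor
  · rintro ⟨hk, hkS⟩
    exact ⟨_, hkS, ofScaled_toScaled hm ha hk⟩
  · rintro ⟨x, hx, rfl⟩
    exact ⟨waveNumber_pos hm (hS x hx), by rwa [toScaled_ofScaled hm ha (hS x hx)]⟩

end

theorem corresponds_of_toScaled {A : ℝ} {n : ℕ} (hn : 1 ≤ n) {k : ℝ × ℝ}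
    (hk : 0 < k.1) {x : ℝ × ℝ} (hx : toScaled (waveScale n) (4 * Real.pi * A) k = x) (γ : ℝ) :
    Corresponds A n k.1 k.2 (k.1 / 2 + k.1 * γ / waveScale n * Complex.I) x.1 γ x.2 := by
  have hm := waveScale_pos hn
  subst hx
  refine ⟨hk, ?_, ?_, rfl⟩
  · simp only [toScaled]
    field_simp
  · simp only [toScaled]
    field_simp

/-- A growing mode of the Rayleigh equation yields instability of the shear under 3D Euler. -/
theorem Corresponds.linearlyUnstable {A : ℝ} {n : ℕ} {k₁ k₃ : ℝ} {σ : ℂ} {μ γ b : ℝ}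
    (h : Corresponds A n k₁ k₃ σ μ γ b) (hn : 1 ≤ n) (hγ : 0 < γ) (hσ : 0 < σ.im)
    (hb : b ∈ Ioo 0 3.1)
    (hζ : (rayleighShoot (waveScale n / 2) 0 1 (μ, γ, b)).1 (waveScale n / 2) ≠ 0)
    (hR : (slopeAt (waveScale n / 2) (μ, γ, b)).re = 0) :
    LinearlyUnstable 0 1 profileU (profileW A n) := by
  obtain ⟨v, vd, hv, hd⟩ := h.exists_isRayleighMode hn hb hζ hR
  have hk₁ := h.pos
  refine linearlyUnstable_of_rayleigh contDiff_profileU (contDiff_profileW A n) hσ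
    (k₁ := k₁) (k₃ := k₃) (by positivity) (fun y hy => (hd y hy).1) (fun y hy => ?_)
    hv.left hv.right hv.nontrivial (h.contDiffOn hn hb hv)
  rw [h.rayleigh_coeff hn (Or.inr hγ.ne')]
  exact (hd y hy).2

theorem theorem4p1 (A : ℝ) (hA : 0 < A) :
    ∃ C : ℝ, 0 < C ∧ ∀ n : ℕ, 1 ≤ n →
      LinearlyUnstable 0 1 profileU (profileW A n) ∧
      ∃ (Ω : Set (ℝ × ℝ)) (σ : ℝ × ℝ → ℂ) (κ₁ κ₂ : ℝ) (K : ℝ → ℝ),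
        -- the surface of unstable modes: the graph of `σ` over `Ω`
        IsOpen Ω ∧ IsConnected Ω ∧ ContinuousOn σ Ω ∧
        (∀ k ∈ Ω, 0 < (σ k).im ∧
          (∃ v : ℝ → ℂ, IsRayleighMode 0 1 profileU (profileW A n) k.1 k.2 (σ k) v) ∧
          ∀ v : ℝ → ℂ, IsRayleighMode 0 1 profileU (profileW A n) k.1 k.2 (σ k) v →
            ContDiffOn ℝ ∞ v (Ioo 0 1)) ∧
        -- the curve of neutral modes `(K κ, κ * K κ; K κ / 2)` from which it stems
        κ₁ < κ₂ ∧ ContinuousOn K (Ioo κ₁ κ₂) ∧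
        ∀ κ ∈ Ioo κ₁ κ₂,
          C * (n : ℝ) ^ 2 ≤ K κ ^ 2 + (κ * K κ) ^ 2 ∧
          (∃ v : ℝ → ℂ,
            IsRayleighMode 0 1 profileU (profileW A n) (K κ) (κ * K κ) ((K κ : ℂ) / 2) v) ∧
          (∀ v : ℝ → ℂ,
            IsRayleighMode 0 1 profileU (profileW A n) (K κ) (κ * K κ) ((K κ : ℂ) / 2) v →
              ContDiffOn ℝ ∞ v (Ioo 0 1)) ∧
          (K κ, κ * K κ) ∈ frontier Ω ∧
          Tendsto σ (𝓝[Ω] (K κ, κ * K κ)) (𝓝 ((K κ : ℂ) / 2)) := by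
  refine ⟨1, one_pos, fun n hn => ?_⟩
  have hpi := Real.pi_gt_three
  set m := waveScale n with hm_def
  have hm : 0 < m := waveScale_pos hn
  have hn1 : (1 : ℝ) ≤ n := by exact_mod_cast hn
  set T := m / 2 with hT_def
  have hT : 0 < T := by positivity
  have hT2 : 3 * Real.pi / 4 ≤ T := by
    rw [hT_def, hm_def, waveScale]
    nlinarith
  set a := 4 * Real.pi * A with ha_def
  have ha : 0 < a := by positivity
  obtain ⟨μ₀, hμ₀, h0⟩ := exists_neutral hT2
  obtain ⟨hs, hζ, -⟩ := decay_eq_evenSol hT.le h0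
  have hgood : ∀ᶠ p : ℝ × ℝ × ℝ in 𝓝 (μ₀, 0, 3),
      p.2.2 ∈ Ioo 0 3.1 ∧ (rayleighShoot T 0 1 p).1 T ≠ 0 :=
    (eventually_decay (p₀ := (μ₀, 0, 3)) hT.le three_mem_Ioo hζ one_pos).mono
      fun p hp => ⟨hp.1, hp.2.1⟩
  obtain ⟨δ, β, M, Γ, hδ, hδd, hβ, hMc, hM, hΓc, hΓ, hΓ0⟩ := exists_zero_surface
    (R := fun p => (slopeAt T p).re) (μ₀ := μ₀) (b₀ := 3) (d := 1 / 100) (by norm_num)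
    (by simp only [hs, Complex.zero_re])
    (hgood.mono fun p hp => Complex.continuous_re.continuousAt.comp
      (continuousAt_slopeAt hT.le hp.1 hp.2)) hgood
    (slopeAt_lt_of_lt hT h0) (slopeAt_lt_of_growth_lt hT h0)
  set S := subgraph μ₀ δ 3 β M with hS_def
  have hSpos : ∀ x ∈ S, 0 < x.1 := fun x hx => by linarith [hx.2.1]
  have hJ : ∀ {κ}, κ ∈ Ioo ((3 - β) / a) ((3 + β) / a) → a * κ ∈ Ioo (3 - β) (3 + β) := fun hκ => by
    have h1 := (div_lt_iff₀ ha).1 hκ.1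
    have h2 := (lt_div_iff₀ ha).1 hκ.2
    constructor <;> linarith
  let σ : ℝ × ℝ → ℂ := fun k => k.1 / 2 + k.1 * Γ (toScaled m a k) / m * Complex.I
  have hσim : ∀ k, (σ k).im = k.1 * Γ (toScaled m a k) / m := fun k => by
    have : σ k = ((k.1 / 2 : ℝ) : ℂ) + ((k.1 * Γ (toScaled m a k) / m : ℝ) : ℂ) * Complex.I := by
      simp only [σ]
      push_cast
      rfl
    rw [this]
    simp
  have hcor : ∀ k ∈ waveRegion m a S, Corresponds A n k.1 k.2 (σ k) (toScaled m a k).1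
      (Γ (toScaled m a k)) (toScaled m a k).2 := fun k hk =>
    corresponds_of_toScaled hn hk.1 rfl _
  have hσpos : ∀ k ∈ waveRegion m a S, 0 < (σ k).im := fun k hk => by
    rw [hσim]
    exact div_pos (mul_pos hk.1 (hΓ _ hk.2).1) hm
  have hMδ : ∀ b ∈ Ioo (3 - β) (3 + β), μ₀ - δ < M b := fun b hb => (hM b hb).1
  have hconn : IsConnected (waveRegion m a S) := by
    rw [waveRegion_eq_image hm ha.ne' hSpos]
    exact (isConnected_subgraph hβ hMc hMδ).image _ continuous_ofScaled.continuousOn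
  have hopen : IsOpen (waveRegion m a S) := isOpen_waveRegion (isOpen_subgraph hMc)
  have hts : ContinuousOn (toScaled m a) (waveRegion m a S) :=
    continuousOn_toScaled.mono fun k hk => hk.1
  refine ⟨?_, waveRegion m a S, σ, (3 - β) / a, (3 + β) / a,
    fun κ => waveNumber m a (M (a * κ), a * κ), hopen, hconn, ?_, fun k hk => ⟨hσpos k hk, ?_, ?_⟩,
    ?_, ?_, fun κ hκ => ?_⟩
  · obtain ⟨k, hk⟩ := hconn.nonempty
    obtain ⟨g1, g2, g3⟩ := hΓ _ hk.2
    exact (hcor k hk).linearlyUnstable hn g1 (hσpos k hk) g3.1 g3.2 g2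
  · have h1 : ContinuousOn (fun k => ((Γ (toScaled m a k) : ℝ) : ℂ)) (waveRegion m a S) :=
      Complex.continuous_ofReal.comp_continuousOn (hΓc.comp hts fun k hk => hk.2)
    have h2 : Continuous fun k : ℝ × ℝ => ((k.1 : ℝ) : ℂ) := by fun_prop
    exact (h2.div_const 2).continuousOn.add
      (((h2.continuousOn.mul h1).div_const _).mul continuousOn_const)
  · obtain ⟨g1, g2, g3⟩ := hΓ _ hk.2
    obtain ⟨v, -, hv, -⟩ := (hcor k hk).exists_isRayleighMode hn g3.1 g3.2 g2
    exact ⟨v, hv⟩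
  · intro v hv
    exact (hcor k hk).contDiffOn hn (hΓ _ hk.2).2.2.1 hv
  · gcongr
    linarith
  · have h1 : ContinuousOn (fun κ => M (a * κ)) (Ioo ((3 - β) / a) ((3 + β) / a)) :=
      hMc.comp (by fun_prop) fun κ hκ => hJ hκ
    exact continuous_waveNumber.comp_continuousOn (h1.prodMk (by fun_prop))
  · have hb := hJ hκ
    obtain ⟨m1, m2, m3⟩ := hM _ hb
    set x : ℝ × ℝ := (M (a * κ), a * κ) with hx_def
    have hx : 0 < x.1 := by
      simp only [hx_def]
      linarith
    have hk : (waveNumber m a x, κ * waveNumber m a x) = ofScaled m a x := by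
      rw [ofScaled, hx_def, mul_div_cancel_left₀ _ ha.ne']
    have hkpos := waveNumber_pos (a := a) hm hx
    have hto : toScaled m a (waveNumber m a x, κ * waveNumber m a x) = x := by
      rw [hk, toScaled_ofScaled hm ha.ne' hx]
    have hc := corresponds_of_toScaled (A := A) hn (k := (waveNumber m a x, κ * waveNumber m a x))
      hkpos hto 0
    simp only [Complex.ofReal_zero, mul_zero, zero_div, zero_mul, add_zero] at hc
    refine ⟨?_, ?_, fun v hv => hc.contDiffOn hn m3.1 hv, ?_, ?_⟩
    · have hE := hc.energy
      rw [hE, one_mul, waveScale]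
      have hx1 : 1 / 100 ≤ x.1 := by
        simp only [hx_def]
        linarith
      have hpi2 : 9 ≤ Real.pi ^ 2 := by nlinarith
      calc (n : ℝ) ^ 2 ≤ 16 * n ^ 2 * 9 * (1 / 100) := by nlinarith [sq_nonneg (n : ℝ)]
        _ ≤ 16 * n ^ 2 * Real.pi ^ 2 * x.1 := by gcongr
        _ = _ := by ring
    · obtain ⟨v, -, hv, -⟩ := hc.exists_isRayleighMode hn m3.1 m3.2 m2
      exact ⟨v, hv⟩
    · rw [hopen.frontier_eq]
      refine ⟨?_, fun hmem => ?_⟩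
      · have hxcl : x ∈ closure S := by
          have h1 : M (a * κ) ∈ closure (Ioo (μ₀ - δ) (M (a * κ))) := by
            rw [closure_Ioo m1.ne]
            exact ⟨m1.le, le_rfl⟩
          have h2 : MapsTo (fun μ : ℝ => (μ, a * κ)) (Ioo (μ₀ - δ) (M (a * κ))) S :=
            fun μ hμ => ⟨hb, hμ.1, hμ.2⟩
          exact h2.closure (by fun_prop) h1
        rw [waveRegion_eq_image hm ha.ne' hSpos, hk]
        exact image_closure_subset_closure_image continuous_ofScaled ⟨x, hxcl, rfl⟩
      · have := hmem.2
        rw [hto] at this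
        exact lt_irrefl _ this.2.2
    · have h1 : Tendsto (toScaled m a) (𝓝[waveRegion m a S] (waveNumber m a x, κ * waveNumber m a x))
          (𝓝[S] x) := by
        refine tendsto_nhdsWithin_iff.2 ⟨?_, ?_⟩
        · have := (continuousOn_toScaled (m := m) (a := a)).continuousAt
            (isOpen_pos_fst.mem_nhds (show (waveNumber m a x, κ * waveNumber m a x) ∈ _ from hkpos))
          rw [ContinuousAt, hto] at this
          exact this.mono_left nhdsWithin_le_nhds
        · filter_upwards [self_mem_nhdsWithin] with k hk using hk.2
      have h2 : Tendsto (fun k => ((Γ (toScaled m a k) : ℝ) : ℂ))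
          (𝓝[waveRegion m a S] (waveNumber m a x, κ * waveNumber m a x)) (𝓝 ((0 : ℝ) : ℂ)) :=
        (Complex.continuous_ofReal.tendsto 0).comp ((hΓ0 _ hb).comp h1)
      have h3 : Tendsto (fun k : ℝ × ℝ => ((k.1 : ℝ) : ℂ))
          (𝓝[waveRegion m a S] (waveNumber m a x, κ * waveNumber m a x))
          (𝓝 (waveNumber m a x : ℂ)) :=
        ((show Continuous fun k : ℝ × ℝ => ((k.1 : ℝ) : ℂ) by fun_prop).tendsto
          (waveNumber m a x, κ * waveNumber m a x)).mono_left nhdsWithin_le_nhds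
      have := (h3.div_const 2).add (((h3.mul h2).div_const (m : ℂ)).mul_const Complex.I)
      simpa only [Complex.ofReal_zero, mul_zero, zero_div, zero_mul, add_zero] using this
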